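/- Let $V:\mathbb R^n\to\mathbb R$ be a $\mathcal C^2$ function whose Hessian matrix $\mathrm{Hess}\,V(x)$ is positive definite at every $x\in\mathbb R^n$, and assume that $d\mu=e^{-V}dx$ is a probability measure on $\mathbb R^n$. Let $f:\mathbb R^n\to\mathbb R$ be a smooth ($\mathcal C^\infty$) function which is $\mu$-integrable with $\int f\,d\mu=0$ and such that $\int \nabla f\cdot(\mathrm{Hess}\,V)^{-1}\nabla f\,d\mu<\infty$. Then $f\in L^2(\mu)$, the function $\frac{\left(f-\nabla f\cdot(\mathrm{Hess}\,V)^{-1}\nabla V\right)^2}{n+\nabla V\cdot(\mathrm{Hess}\,V)^{-1}\nabla V}$ is $\mu$-integrable, and $$ \mathrm{Var}_\mu(f)\le\int\nabla f\cdot(\mathrm{Hess}\,V)^{-1}\nabla f\,d\mu-\int\frac{\left(f-\nabla f\cdot(\mathrm{Hess}\,V)^{-1}\nabla V\right)^2}{n+\nabla V\cdot(\mathrm{Hess}\,V)^{-1}\nabla V}\,d\mu , $$ where $\mathrm{Var}_\mu(f)=\int f^2\,d\mu-\left(\int f\,d\mu\right)^2$. -/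

import Mathlib

open scoped ContDiff

noncomputable section

/-- The Hessian matrix `(∂ᵢ∂ⱼ V (x))ᵢⱼ` of a function `V` on `ℝⁿ`. -/
def hessianMatrix {n : ℕ} (V : EuclideanSpace ℝ (Fin n) → ℝ) (x : EuclideanSpace ℝ (Fin n)) :
    Matrix (Fin n) (Fin n) ℝ :=
  Matrix.of fun i j =>
    fderiv ℝ (fun y => fderiv ℝ V y (EuclideanSpace.single j 1)) x (EuclideanSpace.single i 1)

/-- The quantity `∇f · (Hess V)⁻¹ ∇g` at the point `x`. -/
def gradHessInv {n : ℕ} (V f g : EuclideanSpace ℝ (Fin n) → ℝ) (x : EuclideanSpace ℝ (Fin n)) :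
    ℝ :=
  (gradient f x).ofLp ⬝ᵥ ((hessianMatrix V x)⁻¹).mulVec (gradient g x).ofLp

end

open MeasureTheory Filter Topology

/-! The proof is Hörmander's `L²` duality argument with the dimension kept. Write `L h = Δh - ∇V·∇h`
and let `h` be a test function. Expanding `(L h - f)²` and integrating by parts gives `∫ f² dμ = -2
∫ ∇f·∇h dμ - ∫ (L h)² dμ + ∫ (L h - f)² dμ`, and the integrated Bochner formula replaces `∫ (L h)²
dμ` by `∫ (‖Hess h‖² + ∇h·Hess V ∇h) dμ`. Since `‖Hess h‖² ≥ (Δh)²/n` and `Δh = L h + ∇V·∇h`, the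
integrand is then, up to `(L h - f)²`, a concave quadratic function of `∇h` with `L h` as a
parameter. Its maximum is computed pointwise in `Matrix.PosDef.dimensional_bound` and is the
Brascamp–Lieb integrand with `L h` in place of `f` in the defect term (`integral_sq_le_of_test`).

It remains to let `L h` tend to `f` in `L²(μ)`, that is, to show that the orthogonal complement of
`L(C_c^∞)` consists of constants. If `g` is orthogonal, `w = g e^{-V}` solves `Δw + div(w∇V) = 0`
weakly. Regularity theory is avoided: `w` is mollified, and a Caccioppoli estimate for `u = e^V (ρ *
w)` bounds its gradient by the slope of a cutoff and the oscillation of `∇V` at the mollification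
scale. Both can be made arbitrarily small because `∫ w² e^V = ∫ g² dμ` is finite, so `g` has zero
weak gradient. No lower bound on `Hess V` at infinity is needed.

This proves the inequality when `f` is already in `L²(μ)`. In general it is applied to the centred
bounded truncations `k sin(f/k)`, whose energy is at most that of `f`; Fatou's lemma then gives `f ∈
L²(μ)`. -/

/-- The partial derivative `∂ᵢ u`. -/
noncomputable def partialDeriv {n : ℕ} (i : Fin n) (u : EuclideanSpace ℝ (Fin n) → ℝ)
    (x : EuclideanSpace ℝ (Fin n)) : ℝ :=
  fderiv ℝ u x (EuclideanSpace.single i 1)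

/-- The operator `L h = Δ h - ∇V · ∇h`. -/
noncomputable def weightedLaplacian {n : ℕ} (V h : EuclideanSpace ℝ (Fin n) → ℝ)
    (x : EuclideanSpace ℝ (Fin n)) : ℝ :=
  ∑ i, (partialDeriv i (partialDeriv i h) x - partialDeriv i V x * partialDeriv i h x)

/-! ### Calculus of partial derivatives and of the weighted Laplacian -/

section Calculus

variable {n : ℕ} {u v V h : EuclideanSpace ℝ (Fin n) → ℝ}

theorem hessianMatrix_apply (V : EuclideanSpace ℝ (Fin n) → ℝ) (x : EuclideanSpace ℝ (Fin n))
    (i j : Fin n) : hessianMatrix V x i j = partialDeriv i (partialDeriv j V) x := rfl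

theorem gradient_apply (hu : ContDiff ℝ 1 u) (x : EuclideanSpace ℝ (Fin n)) (i : Fin n) :
    (gradient u x).ofLp i = partialDeriv i u x := by
  have h := (hu.differentiable one_ne_zero x).hasGradientAt.hasFDerivAt.fderiv
  unfold partialDeriv
  rw [h, InnerProductSpace.toDual_apply_apply, EuclideanSpace.inner_single_right]
  simp

theorem ContDiff.partialDeriv {m k : ℕ∞ω} (hu : ContDiff ℝ m u) (hk : k + 1 ≤ m) (i : Fin n) :
    ContDiff ℝ k (partialDeriv i u) :=
  (hu.fderiv_right hk).clm_apply contDiff_const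

theorem ContDiff.continuous_partialDeriv (hu : ContDiff ℝ 1 u) (i : Fin n) :
    Continuous (_root_.partialDeriv i u) :=
  (hu.partialDeriv (k := 0) (by norm_num) i).continuous

theorem HasCompactSupport.partialDeriv (hu : HasCompactSupport u) (i : Fin n) :
    HasCompactSupport (partialDeriv i u) :=
  hu.fderiv_apply ℝ _

theorem partialDeriv_mul (hu : ContDiff ℝ 1 u) (hv : ContDiff ℝ 1 v) (i : Fin n)
    (x : EuclideanSpace ℝ (Fin n)) :
    partialDeriv i (fun y => u y * v y) x
      = u x * partialDeriv i v x + v x * partialDeriv i u x := by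
  unfold partialDeriv
  rw [fderiv_fun_mul (hu.differentiable one_ne_zero x) (hv.differentiable one_ne_zero x)]
  simp

theorem partialDeriv_sub (hu : ContDiff ℝ 1 u) (hv : ContDiff ℝ 1 v) (i : Fin n)
    (x : EuclideanSpace ℝ (Fin n)) :
    partialDeriv i (fun y => u y - v y) x = partialDeriv i u x - partialDeriv i v x := by
  unfold partialDeriv
  rw [fderiv_fun_sub (hu.differentiable one_ne_zero x) (hv.differentiable one_ne_zero x)]
  simp

theorem partialDeriv_add (hu : ContDiff ℝ 1 u) (hv : ContDiff ℝ 1 v) (i : Fin n)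
    (x : EuclideanSpace ℝ (Fin n)) :
    partialDeriv i (fun y => u y + v y) x = partialDeriv i u x + partialDeriv i v x := by
  unfold partialDeriv
  rw [fderiv_fun_add (hu.differentiable one_ne_zero x) (hv.differentiable one_ne_zero x)]
  simp

theorem partialDeriv_sum {ι : Type*} (s : Finset ι) {w : ι → EuclideanSpace ℝ (Fin n) → ℝ}
    (hw : ∀ k, ContDiff ℝ 1 (w k)) (i : Fin n) (x : EuclideanSpace ℝ (Fin n)) :
    partialDeriv i (fun y => ∑ k ∈ s, w k y) x = ∑ k ∈ s, partialDeriv i (w k) x := by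
  unfold partialDeriv
  rw [fderiv_fun_sum fun k _ => (hw k).differentiable one_ne_zero x]
  simp

theorem partialDeriv_comp {φ : ℝ → ℝ} (hφ : ContDiff ℝ 1 φ) (hu : ContDiff ℝ 1 u) (i : Fin n)
    (x : EuclideanSpace ℝ (Fin n)) :
    partialDeriv i (fun y => φ (u y)) x = deriv φ (u x) * partialDeriv i u x := by
  have h := (hφ.differentiable one_ne_zero (u x)).hasDerivAt.comp_hasFDerivAt x
    (hu.differentiable one_ne_zero x).hasFDerivAt
  have h' : fderiv ℝ (fun y => φ (u y)) x = _ := h.fderiv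
  simp [partialDeriv, h']

theorem partialDeriv_exp (hu : ContDiff ℝ 1 u) (i : Fin n) (x : EuclideanSpace ℝ (Fin n)) :
    partialDeriv i (fun y => Real.exp (u y)) x = Real.exp (u x) * partialDeriv i u x := by
  rw [partialDeriv_comp Real.contDiff_exp hu]
  simp

theorem partialDeriv_neg (i : Fin n) (x : EuclideanSpace ℝ (Fin n)) :
    partialDeriv i (fun y => - u y) x = - partialDeriv i u x := by
  simp [partialDeriv, fderiv_fun_neg]

theorem partialDeriv_comm (hu : ContDiff ℝ 2 u) (i j : Fin n) (x : EuclideanSpace ℝ (Fin n)) :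
    partialDeriv i (partialDeriv j u) x = partialDeriv j (partialDeriv i u) x := by
  have hs : IsSymmSndFDerivAt ℝ u x := hu.contDiffAt.isSymmSndFDerivAt (by simp)
  have hd : DifferentiableAt ℝ (fderiv ℝ u) x :=
    (hu.fderiv_right (m := 1) (by norm_num)).differentiable one_ne_zero x
  unfold partialDeriv
  rw [fderiv_clm_apply hd (differentiableAt_const _), fderiv_clm_apply hd (differentiableAt_const _)]
  simpa using hs _ _

/-- Reflection in the argument: `∂ᵢ (t ↦ u (x - t))`. -/
theorem partialDeriv_comp_const_sub (hu : ContDiff ℝ 1 u) (i : Fin n)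
    (x t : EuclideanSpace ℝ (Fin n)) :
    partialDeriv i (fun s => u (x - s)) t = - partialDeriv i u (x - t) := by
  have h := (hu.differentiable one_ne_zero (x - t)).hasFDerivAt.comp t
    ((hasFDerivAt_id t).const_sub x)
  have h' : fderiv ℝ (fun s => u (x - s)) t = _ := h.fderiv
  simp [partialDeriv, h']

theorem continuous_weightedLaplacian (hV : ContDiff ℝ 1 V) (hh : ContDiff ℝ 2 h) :
    Continuous (weightedLaplacian V h) := by
  unfold weightedLaplacian
  refine continuous_finsetSum _ fun i _ => ?_
  exact ((hh.partialDeriv (k := 1) (by norm_num) i).continuous_partialDeriv i).sub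
    ((hV.continuous_partialDeriv i).mul ((hh.of_le (by norm_num)).continuous_partialDeriv i))

theorem contDiff_weightedLaplacian (hV : ContDiff ℝ 2 V) (hh : ContDiff ℝ 3 h) :
    ContDiff ℝ 1 (weightedLaplacian V h) := by
  unfold weightedLaplacian
  refine ContDiff.sum fun i _ => ?_
  exact ((hh.partialDeriv (k := 2) (by norm_num) i).partialDeriv (by norm_num) i).sub
    ((hV.partialDeriv (by norm_num) i).mul
      ((hh.of_le (by norm_num : (2 : ℕ∞ω) ≤ 3)).partialDeriv (by norm_num) i))

theorem HasCompactSupport.weightedLaplacian (hh : HasCompactSupport h)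
    (V : EuclideanSpace ℝ (Fin n) → ℝ) : HasCompactSupport (weightedLaplacian V h) := by
  refine HasCompactSupport.intro (K := tsupport h) hh fun x hx => ?_
  have h0 : ∀ {v : EuclideanSpace ℝ (Fin n) → ℝ}, tsupport v ⊆ tsupport h → ∀ i,
      tsupport (_root_.partialDeriv i v) ⊆ tsupport h := fun hv i =>
    (tsupport_fderiv_apply_subset ℝ _).trans hv
  refine Finset.sum_eq_zero fun i _ => ?_
  rw [image_eq_zero_of_notMem_tsupport fun hx' => hx (h0 le_rfl i hx'),
    image_eq_zero_of_notMem_tsupport fun hx' => hx (h0 (h0 le_rfl i) i hx')]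
  simp

theorem weightedLaplacian_add (V : EuclideanSpace ℝ (Fin n) → ℝ)
    (hu : ContDiff ℝ 2 u) (hv : ContDiff ℝ 2 v) :
    weightedLaplacian V (u + v) = weightedLaplacian V u + weightedLaplacian V v := by
  have h1 : ∀ i, partialDeriv i (u + v) = fun y => partialDeriv i u y + partialDeriv i v y :=
    fun i => funext fun x => partialDeriv_add (hu.of_le (by norm_num)) (hv.of_le (by norm_num)) i x
  ext x
  simp only [weightedLaplacian, h1, Pi.add_apply, ← Finset.sum_add_distrib]
  refine Finset.sum_congr rfl fun i _ => ?_
  rw [partialDeriv_add (hu.partialDeriv (by norm_num) i) (hv.partialDeriv (by norm_num) i)]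
  ring

theorem weightedLaplacian_smul (V : EuclideanSpace ℝ (Fin n) → ℝ) (c : ℝ)
    (hu : ContDiff ℝ 2 u) :
    weightedLaplacian V (c • u) = c • weightedLaplacian V u := by
  have h0 : ∀ {w : EuclideanSpace ℝ (Fin n) → ℝ}, ContDiff ℝ 1 w → ∀ i,
      partialDeriv i (c • w) = c • partialDeriv i w := fun hw i => funext fun x => by
    simp [partialDeriv, fderiv_const_smul (hw.differentiable one_ne_zero x)]
  ext x
  simp only [weightedLaplacian, h0 (hu.of_le (by norm_num)), Pi.smul_apply, smul_eq_mul,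
    Finset.mul_sum, h0 (hu.partialDeriv (k := 1) (by norm_num) _)]
  exact Finset.sum_congr rfl fun i _ => by ring

end Calculus

/-! ### Integration by parts and the integrated Bochner formula -/

section IntegrationByParts

variable {n : ℕ} {u v V h : EuclideanSpace ℝ (Fin n) → ℝ}

theorem integral_mul_partialDeriv (hu : ContDiff ℝ 1 u) (hv : ContDiff ℝ 1 v)
    (hvc : HasCompactSupport v) (i : Fin n) :
    ∫ x, u x * partialDeriv i v x = - ∫ x, partialDeriv i u x * v x := by
  refine integral_mul_fderiv_eq_neg_fderiv_mul_of_integrable ?_ ?_ ?_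
    (fun x _ => hu.differentiable one_ne_zero x) (fun x _ => hv.differentiable one_ne_zero x)
  · exact ((hu.continuous_partialDeriv i).mul hv.continuous).integrable_of_hasCompactSupport
      hvc.mul_left
  · exact (hu.continuous.mul (hv.continuous_partialDeriv i)).integrable_of_hasCompactSupport
      (hvc.partialDeriv i).mul_left
  · exact (hu.continuous.mul hv.continuous).integrable_of_hasCompactSupport hvc.mul_left

/-- Integration by parts for the weighted Laplacian: `∫ u L h e^{-V} = - ∫ ∇u · ∇h e^{-V}`. -/
theorem integral_mul_weightedLaplacian (hV : ContDiff ℝ 1 V) (hu : ContDiff ℝ 1 u)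
    (hh : ContDiff ℝ 2 h) (hhc : HasCompactSupport h) :
    ∫ x, u x * weightedLaplacian V h x * Real.exp (-V x)
      = - ∫ x, (∑ i, partialDeriv i u x * partialDeriv i h x) * Real.exp (-V x) := by
  have hexp : ContDiff ℝ 1 fun x => Real.exp (-V x) := hV.neg.exp
  have hh' : ∀ i, ContDiff ℝ 1 (partialDeriv i h) := hh.partialDeriv (by norm_num)
  have hd : ∀ i x, partialDeriv i (fun y => u y * Real.exp (-V y)) x
      = (partialDeriv i u x - u x * partialDeriv i V x) * Real.exp (-V x) := fun i x => by
    rw [partialDeriv_mul hu hexp, partialDeriv_exp hV.neg, partialDeriv_neg]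
    ring
  have hint : ∀ i, ∀ w : EuclideanSpace ℝ (Fin n) → ℝ, Continuous w →
      Integrable fun x => w x * partialDeriv i h x := fun i w hw =>
    (hw.mul (hh' i).continuous).integrable_of_hasCompactSupport (hhc.partialDeriv i).mul_left
  have hint' : ∀ i, ∀ w : EuclideanSpace ℝ (Fin n) → ℝ, Continuous w →
      Integrable fun x => w x * partialDeriv i (partialDeriv i h) x := fun i w hw =>
    (hw.mul ((hh' i).continuous_partialDeriv i)).integrable_of_hasCompactSupport
      ((hhc.partialDeriv i).partialDeriv i).mul_left
  -- The weight is grouped with `u`; differentiating it produces exactly the term that cancels the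
  -- drift in `L`.
  have key : ∀ i, ∫ x, (u x * Real.exp (-V x)) * partialDeriv i (partialDeriv i h) x
      = - ∫ x, ((partialDeriv i u x - u x * partialDeriv i V x) * Real.exp (-V x))
          * partialDeriv i h x := fun i => by
    rw [integral_mul_partialDeriv (hu.mul hexp) (hh' i) (hhc.partialDeriv i)]
    simp only [hd]
  have hc1 : Continuous fun x => u x * Real.exp (-V x) := (hu.mul hexp).continuous
  have hc2 : ∀ i, Continuous fun x => u x * Real.exp (-V x) * partialDeriv i V x :=
    fun i => hc1.mul (hV.continuous_partialDeriv i)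
  have hc3 : ∀ i, Continuous fun x => partialDeriv i u x * Real.exp (-V x) :=
    fun i => (hu.continuous_partialDeriv i).mul hexp.continuous
  have e1 : ∀ x, u x * weightedLaplacian V h x * Real.exp (-V x)
      = ∑ i, (u x * Real.exp (-V x) * partialDeriv i (partialDeriv i h) x
          - u x * Real.exp (-V x) * partialDeriv i V x * partialDeriv i h x) := fun x => by
    rw [weightedLaplacian, Finset.mul_sum, Finset.sum_mul]
    exact Finset.sum_congr rfl fun i _ => by ring
  have e2 : ∀ x, (∑ i, partialDeriv i u x * partialDeriv i h x) * Real.exp (-V x)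
      = ∑ i, partialDeriv i u x * Real.exp (-V x) * partialDeriv i h x := fun x => by
    rw [Finset.sum_mul]
    exact Finset.sum_congr rfl fun i _ => by ring
  simp only [e1, e2]
  rw [integral_finsetSum _ fun i _ => (hint' i _ hc1).sub' (hint i _ (hc2 i)),
    integral_finsetSum _ fun i _ => hint i _ (hc3 i), ← Finset.sum_neg_distrib]
  refine Finset.sum_congr rfl fun i _ => ?_
  rw [integral_sub (hint' i _ hc1) (hint i _ (hc2 i)), key i, ← integral_neg, ← integral_neg,
    ← integral_sub _ (hint i _ (hc2 i))]
  · exact integral_congr_ae (.of_forall fun x => by simp only []; ring)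
  · convert! (hint i _ ((hc2 i).sub (hc3 i))) using 2
    simp only [Pi.sub_apply]
    ring

/-- Only the drift coefficients of `L` fail to commute with `∂ⱼ`, and their derivatives are entries
of `Hess V`. This is where the Hessian enters Bochner's formula. -/
theorem partialDeriv_weightedLaplacian (hV : ContDiff ℝ 2 V) (hh : ContDiff ℝ 3 h) (j : Fin n)
    (x : EuclideanSpace ℝ (Fin n)) :
    partialDeriv j (weightedLaplacian V h) x = weightedLaplacian V (partialDeriv j h) x
      - ∑ i, hessianMatrix V x j i * partialDeriv i h x := by
  have hh2 : ContDiff ℝ 2 h := hh.of_le (by norm_num)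
  have h1 : ∀ i, ContDiff ℝ 2 (partialDeriv i h) := hh.partialDeriv (by norm_num)
  have h2 : ∀ i, ContDiff ℝ 1 (partialDeriv i (partialDeriv i h)) :=
    fun i => (h1 i).partialDeriv (by norm_num) i
  have hV1 : ∀ i, ContDiff ℝ 1 (partialDeriv i V) := hV.partialDeriv (by norm_num)
  have h1' : ∀ i, ContDiff ℝ 1 (partialDeriv i h) := fun i => (h1 i).of_le (by norm_num)
  unfold weightedLaplacian
  rw [partialDeriv_sum _ fun i => (h2 i).sub ((hV1 i).mul (h1' i)), ← Finset.sum_sub_distrib]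
  refine Finset.sum_congr rfl fun i _ => ?_
  have hc : partialDeriv i (partialDeriv j h) = partialDeriv j (partialDeriv i h) :=
    funext fun y => partialDeriv_comm hh2 i j y
  rw [partialDeriv_sub (h2 i) ((hV1 i).mul (h1' i)), partialDeriv_mul (hV1 i) (h1' i),
    partialDeriv_comm (h1 i), hc, hessianMatrix_apply]
  ring

/-- The integrated Bochner formula
`∫ (L h)² e^{-V} = ∫ (‖Hess h‖² + ∇h · Hess V ∇h) e^{-V}`. -/
theorem integral_weightedLaplacian_sq (hV : ContDiff ℝ 2 V) (hh : ContDiff ℝ 3 h)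
    (hhc : HasCompactSupport h) :
    ∫ x, weightedLaplacian V h x ^ 2 * Real.exp (-V x)
      = ∫ x, (∑ j, ((∑ i, partialDeriv i (partialDeriv j h) x ^ 2)
          + partialDeriv j h x * ∑ i, hessianMatrix V x j i * partialDeriv i h x))
          * Real.exp (-V x) := by
  have hV1 : ContDiff ℝ 1 V := hV.of_le (by norm_num)
  have h1 : ∀ i, ContDiff ℝ 2 (partialDeriv i h) := hh.partialDeriv (by norm_num)
  have h1' : ∀ i, ContDiff ℝ 1 (partialDeriv i h) := fun i => (h1 i).of_le (by norm_num)
  have hec : Continuous fun x => Real.exp (-V x) := hV1.neg.exp.continuous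
  have hH : ∀ j i, Continuous fun x => hessianMatrix V x j i := fun j i =>
    (hV.partialDeriv (k := 1) (by norm_num) i).continuous_partialDeriv j
  have hI1 : ∀ j, Integrable fun x => partialDeriv j h x
      * weightedLaplacian V (partialDeriv j h) x * Real.exp (-V x) := fun j =>
    (((h1 j).continuous.mul (continuous_weightedLaplacian hV1 (h1 j))).mul
      hec).integrable_of_hasCompactSupport ((hhc.partialDeriv j).mul_right.mul_right)
  have hI2 : ∀ j, Integrable fun x => partialDeriv j h x
      * (∑ i, hessianMatrix V x j i * partialDeriv i h x) * Real.exp (-V x) := fun j =>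
    (((h1 j).continuous.mul (continuous_finsetSum _ fun i _ => (hH j i).mul
      (h1 i).continuous)).mul hec).integrable_of_hasCompactSupport
      ((hhc.partialDeriv j).mul_right.mul_right)
  have hI3 : ∀ j, Integrable fun x => (∑ i, partialDeriv i (partialDeriv j h) x
      * partialDeriv i (partialDeriv j h) x) * Real.exp (-V x) := fun j => by
    simp only [Finset.sum_mul]
    exact integrable_finsetSum _ fun i _ => ((((h1' j).continuous_partialDeriv i).mul
      ((h1' j).continuous_partialDeriv i)).mul hec).integrable_of_hasCompactSupport
      (((hhc.partialDeriv j).partialDeriv i).mul_right.mul_right)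
  have e0 : ∀ x, (∑ i, partialDeriv i (weightedLaplacian V h) x * partialDeriv i h x)
      * Real.exp (-V x) = ∑ j, (partialDeriv j h x * weightedLaplacian V (partialDeriv j h) x
        * Real.exp (-V x) - partialDeriv j h x
        * (∑ i, hessianMatrix V x j i * partialDeriv i h x) * Real.exp (-V x)) := fun x => by
    rw [Finset.sum_mul]
    refine Finset.sum_congr rfl fun j _ => ?_
    rw [partialDeriv_weightedLaplacian hV hh]
    ring
  have e1 : ∀ x, (∑ j, ((∑ i, partialDeriv i (partialDeriv j h) x ^ 2)
          + partialDeriv j h x * ∑ i, hessianMatrix V x j i * partialDeriv i h x))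
          * Real.exp (-V x) = ∑ j, ((∑ i, partialDeriv i (partialDeriv j h) x
      * partialDeriv i (partialDeriv j h) x) * Real.exp (-V x) + partialDeriv j h x
        * (∑ i, hessianMatrix V x j i * partialDeriv i h x) * Real.exp (-V x)) := fun x => by
    rw [Finset.sum_mul]
    refine Finset.sum_congr rfl fun j _ => ?_
    simp only [pow_two]
    ring
  simp only [pow_two (weightedLaplacian V h _)]
  -- Integration by parts is used twice: here with `u = L h`, which is why `L h` must be `C¹`, and
  -- below with `∂ⱼh` in both slots, which turns `∂ⱼh · L ∂ⱼh` into `-|∇∂ⱼh|²`.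
  rw [integral_mul_weightedLaplacian hV1 (contDiff_weightedLaplacian hV hh)
    (hh.of_le (by norm_num)) hhc]
  simp only [e0, e1]
  rw [integral_finsetSum _ fun j _ => (hI1 j).sub' (hI2 j),
    integral_finsetSum _ fun j _ => (hI3 j).fun_add (hI2 j), ← Finset.sum_neg_distrib]
  refine Finset.sum_congr rfl fun j _ => ?_
  rw [integral_sub (hI1 j) (hI2 j), integral_add (hI3 j) (hI2 j),
    integral_mul_weightedLaplacian hV1 (h1' j) (h1 j) (hhc.partialDeriv j)]
  ring

end IntegrationByParts

/-! ### The pointwise quadratic optimisation -/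

section QuadraticForm

open Matrix

variable {n : ℕ} {K : Matrix (Fin n) (Fin n) ℝ}

theorem Matrix.PosDef.dotProduct_mulVec_comm (hK : K.PosDef) (x y : Fin n → ℝ) :
    x ⬝ᵥ K *ᵥ y = y ⬝ᵥ K *ᵥ x := by
  have h : Kᵀ = K := by
    have := hK.isHermitian.eq
    rwa [conjTranspose_eq_transpose_of_trivial] at this
  rw [dotProduct_mulVec, ← mulVec_transpose, h, dotProduct_comm]

theorem Matrix.PosDef.dotProduct_mulVec_self_nonneg (hK : K.PosDef) (x : Fin n → ℝ) :
    0 ≤ x ⬝ᵥ K *ᵥ x := by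
  simpa using hK.posSemidef.dotProduct_mulVec_nonneg x

/-- Cauchy–Schwarz for the inner product of a positive definite matrix. -/
theorem Matrix.PosDef.dotProduct_mulVec_sq_le (hK : K.PosDef) (x y : Fin n → ℝ) :
    (x ⬝ᵥ K *ᵥ y) ^ 2 ≤ (x ⬝ᵥ K *ᵥ x) * (y ⬝ᵥ K *ᵥ y) := by
  have h : ∀ t : ℝ, 0 ≤ (x ⬝ᵥ K *ᵥ x) * (t * t) + (2 * (x ⬝ᵥ K *ᵥ y)) * t + y ⬝ᵥ K *ᵥ y := by
    intro t
    have h0 := hK.dotProduct_mulVec_self_nonneg (t • x + y)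
    have hs := hK.dotProduct_mulVec_comm x y
    simp only [mulVec_add, mulVec_smul, add_dotProduct, dotProduct_add, smul_dotProduct,
      dotProduct_smul, smul_eq_mul] at h0
    rw [← hs] at h0
    linarith
  have := discrim_le_zero h
  rw [discrim] at this
  linarith

/-- This is the Cauchy–Schwarz inequality `(s - t)²/(N + b) ≤ s²/N + t²/b` with `s = a + t`, where
`t²/b` is replaced by its bound `Q` so that `b = 0` is allowed. -/
theorem sq_div_add_le {N a b t Q : ℝ} (hN : 0 < N) (hb : 0 ≤ b) (hQ : 0 ≤ Q)
    (ht : t ^ 2 ≤ b * Q) : a ^ 2 / (N + b) ≤ Q + (a + t) ^ 2 / N := by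
  obtain ⟨s, hs⟩ : ∃ s, s = a + t := ⟨_, rfl⟩
  obtain rfl : a = s - t := by rw [hs]; ring
  rw [div_le_iff₀ (by positivity)]
  have h1 : (s - t + t) ^ 2 / N * N = s ^ 2 := by field_simp; ring
  obtain ⟨m, hm⟩ : ∃ m, m = (s - t + t) ^ 2 / N := ⟨_, rfl⟩
  have hm0 : 0 ≤ m := by rw [hm]; positivity
  rw [← hm] at h1 ⊢
  -- `(-st)² ≤ (N Q) (b m)` yields `-2st ≤ N Q + b m`.
  have h2 : -(2 * (s * t)) ≤ N * Q + b * m := by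
    refine le_of_abs_le (abs_le_of_sq_le_sq ?_ (by positivity))
    have h3 : (s * t) ^ 2 ≤ (N * Q) * (b * m) := by
      calc (s * t) ^ 2 = s ^ 2 * t ^ 2 := by ring
        _ ≤ s ^ 2 * (b * Q) := by gcongr
        _ = _ := by rw [← h1]; ring
    nlinarith [sq_nonneg (N * Q - b * m)]
  nlinarith

/-- Maximisation of the quadratic form behind the dimensional Brascamp–Lieb inequality. -/
theorem Matrix.PosDef.dimensional_bound (hK : K.PosDef) {N : ℝ} (hN : 0 < N) (c : ℝ)
    (v w y : Fin n → ℝ) :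
    -2 * (v ⬝ᵥ K *ᵥ y) - y ⬝ᵥ K *ᵥ y - (c + w ⬝ᵥ K *ᵥ y) ^ 2 / N
      ≤ v ⬝ᵥ K *ᵥ v - (c - v ⬝ᵥ K *ᵥ w) ^ 2 / (N + w ⬝ᵥ K *ᵥ w) := by
  -- Complete the square with `z = y + v`: the left side becomes `v·Kv - z·Kz - (a + w·Kz)²/N` with
  -- `a = c - v·Kw`. The scalar inequality applies with `t = w·Kz`, `b = w·Kw` and `Q = z·Kz`.
  have hz := hK.dotProduct_mulVec_self_nonneg (y + v)
  have hcs := hK.dotProduct_mulVec_sq_le w (y + v)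
  have h := sq_div_add_le (a := c - v ⬝ᵥ K *ᵥ w) hN (hK.dotProduct_mulVec_self_nonneg w) hz hcs
  have e1 : (y + v) ⬝ᵥ K *ᵥ (y + v) = y ⬝ᵥ K *ᵥ y + 2 * (v ⬝ᵥ K *ᵥ y) + v ⬝ᵥ K *ᵥ v := by
    simp only [mulVec_add, add_dotProduct, dotProduct_add]
    rw [hK.dotProduct_mulVec_comm y v]
    ring
  have e2 : c - v ⬝ᵥ K *ᵥ w + w ⬝ᵥ K *ᵥ (y + v) = c + w ⬝ᵥ K *ᵥ y := by
    simp only [mulVec_add, dotProduct_add]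
    rw [hK.dotProduct_mulVec_comm w v]
    ring
  rw [e1, e2] at h
  linarith

end QuadraticForm

/-! ### The inverse Hessian energy -/

section GradHessInv

variable {n : ℕ} {V f g : EuclideanSpace ℝ (Fin n) → ℝ}

theorem continuous_gradient_ofLp (hf : ContDiff ℝ 1 f) :
    Continuous fun x => (gradient f x).ofLp := by
  refine continuous_pi fun i => ?_
  simp only [gradient_apply hf]
  exact hf.continuous_partialDeriv i

theorem continuous_gradHessInv (hV : ContDiff ℝ 2 V) (hVpos : ∀ x, (hessianMatrix V x).PosDef)
    (hf : ContDiff ℝ 1 f) (hg : ContDiff ℝ 1 g) : Continuous (gradHessInv V f g) := by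
  have hH : Continuous fun x => hessianMatrix V x :=
    continuous_matrix fun i j =>
      (hV.partialDeriv (k := 1) (by norm_num) j).continuous_partialDeriv i
  have hI : Continuous fun x => (hessianMatrix V x)⁻¹ := by
    simp only [Matrix.inv_def, Ring.inverse_eq_inv']
    exact (hH.matrix_det.inv₀ fun x => (hVpos x).det_pos.ne').smul hH.matrix_adjugate
  exact (continuous_gradient_ofLp hf).dotProduct (hI.matrix_mulVec (continuous_gradient_ofLp hg))

theorem gradHessInv_self_nonneg (hVpos : ∀ x, (hessianMatrix V x).PosDef)
    (f : EuclideanSpace ℝ (Fin n) → ℝ) (x : EuclideanSpace ℝ (Fin n)) :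
    0 ≤ gradHessInv V f f x :=
  (hVpos x).inv.dotProduct_mulVec_self_nonneg _

theorem gradHessInv_sq_le (hVpos : ∀ x, (hessianMatrix V x).PosDef)
    (f g : EuclideanSpace ℝ (Fin n) → ℝ) (x : EuclideanSpace ℝ (Fin n)) :
    gradHessInv V f g x ^ 2 ≤ gradHessInv V f f x * gradHessInv V g g x :=
  (hVpos x).inv.dotProduct_mulVec_sq_le _ _

theorem gradHessInv_comp {φ : ℝ → ℝ} (hφ : ContDiff ℝ 1 φ) (hf : ContDiff ℝ 1 f)
    (x : EuclideanSpace ℝ (Fin n)) :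
    gradHessInv V (fun y => φ (f y)) (fun y => φ (f y)) x
      = deriv φ (f x) ^ 2 * gradHessInv V f f x := by
  have h : (gradient (fun y => φ (f y)) x).ofLp = deriv φ (f x) • (gradient f x).ofLp := by
    ext i
    rw [gradient_apply (u := fun y => φ (f y)) (hφ.comp hf), partialDeriv_comp hφ hf]
    simp [gradient_apply hf]
  simp only [gradHessInv, h, Matrix.mulVec_smul, smul_dotProduct, dotProduct_smul, smul_eq_mul]
  ring

/-- The pointwise inequality obtained by inserting `∇h` in the dimensional bound, the
squared norm of `Hess h` being bounded below by `(Δ h)² / n`. -/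
theorem pointwise_dimensional_bound (hn : 0 < n) (hVpos : ∀ x, (hessianMatrix V x).PosDef)
    (hV : ContDiff ℝ 1 V) (hf : ContDiff ℝ 1 f) (h : EuclideanSpace ℝ (Fin n) → ℝ)
    (x : EuclideanSpace ℝ (Fin n)) :
    -2 * (∑ i, partialDeriv i f x * partialDeriv i h x)
      - (∑ j, ((∑ i, partialDeriv i (partialDeriv j h) x ^ 2)
          + partialDeriv j h x * ∑ i, hessianMatrix V x j i * partialDeriv i h x))
      ≤ gradHessInv V f f x - (weightedLaplacian V h x - gradHessInv V f V x) ^ 2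
          / ((n : ℝ) + gradHessInv V V V x) := by
  set p : Fin n → ℝ := fun i => partialDeriv i h x
  -- With `K = (Hess V)⁻¹` this choice makes `K y = ∇h`, so `y·Ky` is the curvature term of
  -- Bochner's formula.
  set y : Fin n → ℝ := (hessianMatrix V x).mulVec p with hy
  have hu : IsUnit (hessianMatrix V x).det := (hVpos x).det_pos.ne'.isUnit
  have hKy : ((hessianMatrix V x)⁻¹).mulVec y = p := by
    rw [hy, Matrix.mulVec_mulVec, Matrix.nonsing_inv_mul _ hu, Matrix.one_mulVec]
  have hb := (hVpos x).inv.dimensional_bound (N := n) (by exact_mod_cast hn)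
    (weightedLaplacian V h x) (gradient f x).ofLp (gradient V x).ofLp y
  rw [hKy] at hb
  have e1 : (gradient f x).ofLp ⬝ᵥ p = ∑ i, partialDeriv i f x * partialDeriv i h x := by
    simp [dotProduct, gradient_apply hf, p]
  have e2 : weightedLaplacian V h x + (gradient V x).ofLp ⬝ᵥ p
      = ∑ i, partialDeriv i (partialDeriv i h) x := by
    simp [dotProduct, gradient_apply hV, p, weightedLaplacian]
  have e3 : y ⬝ᵥ p
      = ∑ j, partialDeriv j h x * ∑ i, hessianMatrix V x j i * partialDeriv i h x := by
    rw [dotProduct_comm]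
    simp [dotProduct, p, hy, Matrix.mulVec]
  -- Cauchy–Schwarz on the diagonal of `Hess h`; the off-diagonal entries are discarded.
  have e4 : (∑ i, partialDeriv i (partialDeriv i h) x) ^ 2 / n
      ≤ ∑ j, ∑ i, partialDeriv i (partialDeriv j h) x ^ 2 := by
    rw [div_le_iff₀ (by exact_mod_cast hn)]
    calc (∑ i, partialDeriv i (partialDeriv i h) x) ^ 2
        ≤ (Finset.univ : Finset (Fin n)).card * ∑ i, partialDeriv i (partialDeriv i h) x ^ 2 :=
          sq_sum_le_card_mul_sum_sq
      _ = (∑ i, partialDeriv i (partialDeriv i h) x ^ 2) * n := by simp [mul_comm]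
      _ ≤ _ := by
          gcongr with j
          exact Finset.single_le_sum (f := fun i => partialDeriv i (partialDeriv j h) x ^ 2)
            (fun i _ => sq_nonneg _) (Finset.mem_univ j)
  rw [e1, e2, e3] at hb
  rw [Finset.sum_add_distrib]
  unfold gradHessInv
  linarith

end GradHessInv

/-! ### Mollification and commutator estimates -/

/-- The convolution `ρ * w`. -/
noncomputable def mollify {n : ℕ} (ρ w : EuclideanSpace ℝ (Fin n) → ℝ)
    (x : EuclideanSpace ℝ (Fin n)) : ℝ :=
  ∫ t, ρ (x - t) * w t

section Mollify

open scoped Convolution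

variable {n : ℕ} {ρ w θ : EuclideanSpace ℝ (Fin n) → ℝ}

theorem mollify_eq_convolution (ρ w : EuclideanSpace ℝ (Fin n) → ℝ) :
    mollify ρ w = ρ ⋆[ContinuousLinearMap.lsmul ℝ ℝ, volume] w := by
  ext x
  rw [convolution_lsmul_swap]
  rfl

theorem MeasureTheory.LocallyIntegrable.abs (hw : LocallyIntegrable w) :
    LocallyIntegrable fun t => |w t| :=
  hw.mono hw.aestronglyMeasurable.norm (.of_forall fun t => by simp)

theorem HasCompactSupport.comp_const_sub (hρ : HasCompactSupport ρ)
    (x : EuclideanSpace ℝ (Fin n)) : HasCompactSupport fun t => ρ (x - t) :=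
  hρ.comp_homeomorph (Homeomorph.subLeft x)

theorem integrable_mollify_integrand (hρ : Continuous ρ) (hρc : HasCompactSupport ρ)
    (hw : LocallyIntegrable w) (x : EuclideanSpace ℝ (Fin n)) :
    Integrable fun t => ρ (x - t) * w t :=
  hw.integrable_smul_left_of_hasCompactSupport (hρ.comp (continuous_const.sub continuous_id))
    (hρc.comp_const_sub x)

theorem contDiff_mollify {m : ℕ∞} (hρ : ContDiff ℝ m ρ) (hρc : HasCompactSupport ρ)
    (hw : LocallyIntegrable w) : ContDiff ℝ m (mollify ρ w) := by
  rw [mollify_eq_convolution]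
  exact hρc.contDiff_convolution_left _ hρ hw

theorem partialDeriv_mollify (hρ : ContDiff ℝ 1 ρ) (hρc : HasCompactSupport ρ)
    (hw : LocallyIntegrable w) (i : Fin n) :
    partialDeriv i (mollify ρ w) = mollify (partialDeriv i ρ) w := by
  ext x
  have h := (hρc.hasFDerivAt_convolution_left (ContinuousLinearMap.lsmul ℝ ℝ) hρ hw x).fderiv
  have hint : Integrable fun t => ((ContinuousLinearMap.lsmul ℝ ℝ).precompL
      (EuclideanSpace ℝ (Fin n)) (fderiv ℝ ρ (x - t))) (w t) :=
    ((hρc.fderiv ℝ).convolutionExists_left _ (hρ.continuous_fderiv one_ne_zero)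
      hw x).integrable_swap
  rw [partialDeriv, mollify_eq_convolution, h, convolution_eq_swap,
    ContinuousLinearMap.integral_apply hint]
  rfl

/-- Convolution with an even kernel is self-adjoint, by Fubini; boundedness of `θ` supplies
integrability on the product. -/
theorem integral_mollify_mul (hρ : Continuous ρ) (hρc : HasCompactSupport ρ)
    (hsymm : ∀ t, ρ (-t) = ρ t) (hw : Integrable w) (hθ : Continuous θ)
    (hθc : HasCompactSupport θ) :
    ∫ x, mollify ρ w x * θ x = ∫ t, w t * mollify ρ θ t := by
  obtain ⟨C, hC⟩ := hθ.bounded_above_of_compact_support hθc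
  have h1 := hw.convolution_integrand (ContinuousLinearMap.mul ℝ ℝ)
    (hρ.integrable_of_hasCompactSupport (μ := volume) hρc)
  have h2 : Integrable (fun p : EuclideanSpace ℝ (Fin n) × EuclideanSpace ℝ (Fin n) =>
      θ p.1 * (w p.2 * ρ (p.1 - p.2))) (volume.prod volume) :=
    h1.bdd_mul (hθ.comp continuous_fst).aestronglyMeasurable (.of_forall fun p => hC p.1)
  calc ∫ x, mollify ρ w x * θ x = ∫ x, ∫ t, θ x * (w t * ρ (x - t)) := by
        refine integral_congr_ae (.of_forall fun x => ?_)
        simp only [mollify]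
        rw [mul_comm, ← integral_const_mul]
        exact integral_congr_ae (.of_forall fun t => by ring)
    _ = ∫ t, ∫ x, θ x * (w t * ρ (x - t)) := integral_integral_swap h2
    _ = ∫ t, w t * mollify ρ θ t := by
        refine integral_congr_ae (.of_forall fun t => ?_)
        simp only [mollify]
        rw [← integral_const_mul]
        refine integral_congr_ae (.of_forall fun x => ?_)
        simp only []
        rw [← hsymm (t - x), neg_sub]
        ring

theorem integral_mollify (hρ : Integrable ρ) (hw : Integrable w) :
    ∫ x, mollify ρ w x = (∫ x, ρ x) * ∫ x, w x := by
  rw [mollify_eq_convolution, integral_convolution (ContinuousLinearMap.lsmul ℝ ℝ) hρ hw]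
  rfl

theorem Integrable.mollify (hρ : Integrable ρ) (hw : Integrable w) :
    Integrable (mollify ρ w) := by
  rw [mollify_eq_convolution]
  exact hρ.integrable_convolution _ hw

variable (φ : ContDiffBump (0 : EuclideanSpace ℝ (Fin n)))

theorem integrable_normed_mollify_integrand (hw : LocallyIntegrable w)
    (x : EuclideanSpace ℝ (Fin n)) : Integrable fun t => φ.normed volume (x - t) * w t :=
  integrable_mollify_integrand φ.continuous_normed φ.hasCompactSupport_normed hw x

theorem mollify_normed_nonneg (hw : ∀ t, 0 ≤ w t) (x : EuclideanSpace ℝ (Fin n)) :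
    0 ≤ mollify (φ.normed volume) w x :=
  integral_nonneg fun t => mul_nonneg (φ.nonneg_normed _) (hw t)

theorem integral_normed_const_sub (x : EuclideanSpace ℝ (Fin n)) :
    ∫ t, φ.normed volume (x - t) = 1 := by
  rw [integral_sub_left_eq_self (φ.normed volume) volume x, φ.integral_normed]

theorem normed_eq_zero_of_le_dist {x t : EuclideanSpace ℝ (Fin n)} (h : φ.rOut ≤ dist t x) :
    φ.normed volume (x - t) = 0 := by
  have : x - t ∉ Function.support (φ.normed volume) := by
    rw [φ.support_normed_eq]
    simpa [dist_eq_norm, norm_sub_rev] using h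
  simpa using this

/-- Jensen's inequality for the probability density `ρ(x - ·)`, obtained by expanding `∫ ρ(x - t) (w
t - a)² dt ≥ 0` at the mean `a`. -/
theorem mollify_normed_sq_le (hw : LocallyIntegrable w)
    (hw2 : LocallyIntegrable fun t => w t ^ 2) (x : EuclideanSpace ℝ (Fin n)) :
    mollify (φ.normed volume) w x ^ 2 ≤ mollify (φ.normed volume) (fun t => w t ^ 2) x := by
  set a := mollify (φ.normed volume) w x with ha
  have i0 : Integrable fun t => φ.normed volume (x - t) :=
    φ.integrable_normed.comp_sub_left x
  have i1 := integrable_normed_mollify_integrand φ hw x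
  have i2 := integrable_normed_mollify_integrand φ hw2 x
  have h : 0 ≤ ∫ t, (φ.normed volume (x - t) * w t ^ 2
      - 2 * a * (φ.normed volume (x - t) * w t) + a ^ 2 * φ.normed volume (x - t)) := by
    refine integral_nonneg fun t => ?_
    have : 0 ≤ φ.normed volume (x - t) * (w t - a) ^ 2 :=
      mul_nonneg (φ.nonneg_normed _) (sq_nonneg _)
    simp only [Pi.zero_apply]
    linarith
  rw [integral_add (i2.sub' (i1.const_mul _)) (i0.const_mul _), integral_sub i2 (i1.const_mul _),
    integral_const_mul, integral_const_mul, integral_normed_const_sub] at h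
  change 0 ≤ mollify (φ.normed volume) (fun t => w t ^ 2) x - 2 * a * a + a ^ 2 * 1 at h
  linarith

theorem abs_mollify_normed_le (w : EuclideanSpace ℝ (Fin n) → ℝ) (x : EuclideanSpace ℝ (Fin n)) :
    |mollify (φ.normed volume) w x| ≤ mollify (φ.normed volume) (fun t => |w t|) x := by
  refine (abs_integral_le_integral_abs).trans (le_of_eq ?_)
  refine integral_congr_ae (.of_forall fun t => ?_)
  simp only [abs_mul, abs_of_nonneg (φ.nonneg_normed _)]

/-- Commutator estimate: mollifying `w a` versus multiplying the mollification of `w` by `a`. -/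
theorem abs_mollify_mul_sub_le {a : EuclideanSpace ℝ (Fin n) → ℝ} (ha : Continuous a)
    (hw : LocallyIntegrable w) {x : EuclideanSpace ℝ (Fin n)} {τ : ℝ}
    (hτ : ∀ t, dist t x < φ.rOut → |a t - a x| ≤ τ) :
    |mollify (φ.normed volume) (fun t => w t * a t) x - mollify (φ.normed volume) w x * a x|
      ≤ τ * mollify (φ.normed volume) (fun t => |w t|) x := by
  have hwa : LocallyIntegrable fun t => w t * a t := hw.mul_continuous ha
  have i1 := integrable_normed_mollify_integrand φ hw x
  have i2 := integrable_normed_mollify_integrand φ hwa x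
  have i3 := integrable_normed_mollify_integrand φ hw.abs x
  unfold mollify
  rw [← integral_mul_const, ← integral_sub i2 (i1.mul_const _), ← integral_const_mul]
  refine abs_integral_le_integral_abs.trans (integral_mono (i2.sub' (i1.mul_const _)).abs
    (i3.const_mul τ) fun t => ?_)
  simp only []
  rcases lt_or_ge (dist t x) φ.rOut with h | h
  · have e : φ.normed volume (x - t) * (w t * a t) - φ.normed volume (x - t) * w t * a x
        = φ.normed volume (x - t) * w t * (a t - a x) := by ring
    rw [e, abs_mul, abs_mul, abs_of_nonneg (φ.nonneg_normed _), mul_comm τ]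
    gcongr
    · exact mul_nonneg (φ.nonneg_normed _) (abs_nonneg _)
    · exact hτ t h
  · simp [normed_eq_zero_of_le_dist φ h]

/-- Jensen's inequality, after which `e^V` is moved inside the mollification; the factor 2 pays for
its variation over the support of the kernel. -/
theorem mollify_abs_sq_mul_exp_le {V : EuclideanSpace ℝ (Fin n) → ℝ} (hV : Continuous V)
    (hw : LocallyIntegrable w) (hq : LocallyIntegrable fun t => w t ^ 2 * Real.exp (V t))
    {x : EuclideanSpace ℝ (Fin n)}
    (hx : ∀ t, dist t x < φ.rOut → Real.exp (V x) ≤ 2 * Real.exp (V t)) :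
    mollify (φ.normed volume) (fun t => |w t|) x ^ 2 * Real.exp (V x)
      ≤ 2 * mollify (φ.normed volume) (fun t => w t ^ 2 * Real.exp (V t)) x := by
  have hw2 : LocallyIntegrable fun t => |w t| ^ 2 := by
    have := hq.mul_continuous (g := fun t => Real.exp (-V t)) (by fun_prop)
    refine this.congr (.of_forall fun t => ?_)
    simp [mul_assoc, ← Real.exp_add]
  have i1 := integrable_normed_mollify_integrand φ hw2 x
  have i2 := integrable_normed_mollify_integrand φ hq x
  calc _ ≤ mollify (φ.normed volume) (fun t => |w t| ^ 2) x * Real.exp (V x) := by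
        gcongr
        exact mollify_normed_sq_le φ hw.abs hw2 x
    _ ≤ _ := by
        unfold mollify
        rw [← integral_mul_const, ← integral_const_mul]
        refine integral_mono (i1.mul_const _) (i2.const_mul _) fun t => ?_
        simp only [sq_abs]
        rcases lt_or_ge (dist t x) φ.rOut with h | h
        · have h0 : 0 ≤ φ.normed volume (x - t) * w t ^ 2 :=
            mul_nonneg (φ.nonneg_normed _) (sq_nonneg _)
          nlinarith [mul_le_mul_of_nonneg_left (hx t h) h0]
        · simp [normed_eq_zero_of_le_dist φ h]

end Mollify

/-! ### Weak solutions and the Caccioppoli estimate -/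

section WeakSolution

variable {n : ℕ} {V w : EuclideanSpace ℝ (Fin n) → ℝ}

theorem ContDiff.of_infty {u : EuclideanSpace ℝ (Fin n) → ℝ} (hu : ContDiff ℝ ∞ u) (m : ℕ∞) :
    ContDiff ℝ m u :=
  hu.of_le (WithTop.coe_le_coe.2 le_top)

/-- `w` is a weak (distributional) solution of the Fokker–Planck equation `Δw + div (w ∇V) = 0`. -/
def IsWeakSolution {n : ℕ} (V w : EuclideanSpace ℝ (Fin n) → ℝ) : Prop :=
  ∀ ψ : EuclideanSpace ℝ (Fin n) → ℝ, ContDiff ℝ ∞ ψ → HasCompactSupport ψ →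
    ∫ x, w x * weightedLaplacian V ψ x = 0

/-- The flux of the mollification of a weak solution. -/
noncomputable def mollifiedFlux {n : ℕ} (V ρ w : EuclideanSpace ℝ (Fin n) → ℝ) (i : Fin n)
    (x : EuclideanSpace ℝ (Fin n)) : ℝ :=
  partialDeriv i (mollify ρ w) x + mollify ρ (fun t => w t * partialDeriv i V t) x

theorem contDiff_mollifiedFlux (hV : ContDiff ℝ 1 V) (hw : LocallyIntegrable w)
    {ρ : EuclideanSpace ℝ (Fin n) → ℝ} (hρ : ContDiff ℝ ∞ ρ) (hρc : HasCompactSupport ρ)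
    (i : Fin n) : ContDiff ℝ 1 (mollifiedFlux V ρ w i) :=
  ((contDiff_mollify (m := 2) (hρ.of_infty _) hρc hw).partialDeriv
    (by norm_num) i).add (contDiff_mollify (m := 1) (hρ.of_infty _) hρc
      (hw.mul_continuous (hV.continuous_partialDeriv i)))

/-- The weak equation tested against `t ↦ ρ(x - t)` says that the mollified flux is divergence free
at `x`. The reflection changes the sign of first derivatives, matching the two terms. -/
theorem IsWeakSolution.sum_partialDeriv_mollifiedFlux (hsol : IsWeakSolution V w)
    (hV : ContDiff ℝ 1 V) (hw : LocallyIntegrable w)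
    {ρ : EuclideanSpace ℝ (Fin n) → ℝ} (hρ : ContDiff ℝ ∞ ρ) (hρc : HasCompactSupport ρ)
    (x : EuclideanSpace ℝ (Fin n)) :
    ∑ i, partialDeriv i (mollifiedFlux V ρ w i) x = 0 := by
  have hρ1 : ContDiff ℝ 1 ρ := hρ.of_infty 1
  have hρ2 : ContDiff ℝ 2 ρ := hρ.of_infty 2
  have hdρ : ∀ i, ContDiff ℝ 1 (partialDeriv i ρ) := hρ2.partialDeriv (by norm_num)
  have hwV : ∀ i, LocallyIntegrable fun t => w t * partialDeriv i V t :=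
    fun i => hw.mul_continuous (hV.continuous_partialDeriv i)
  have hW : ContDiff ℝ 2 (mollify ρ w) := contDiff_mollify (m := 2) hρ2 hρc hw
  have h1 : ∀ i, partialDeriv i (mollifiedFlux V ρ w i) x
      = mollify (partialDeriv i (partialDeriv i ρ)) w x
        + mollify (partialDeriv i ρ) (fun t => w t * partialDeriv i V t) x := fun i => by
    have h := partialDeriv_add (hW.partialDeriv (k := 1) (by norm_num) i)
      (contDiff_mollify (m := 1) hρ1 hρc (hwV i)) i x
    rw [partialDeriv_mollify hρ1 hρc hw, partialDeriv_mollify hρ1 hρc (hwV i),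
      partialDeriv_mollify (hdρ i) (hρc.partialDeriv i) hw] at h
    rw [← h]
    unfold mollifiedFlux
    rw [partialDeriv_mollify hρ1 hρc hw]
  have i1 : ∀ i, Integrable fun t => partialDeriv i (partialDeriv i ρ) (x - t) * w t := fun i =>
    integrable_mollify_integrand ((hdρ i).continuous_partialDeriv i)
      ((hρc.partialDeriv i).partialDeriv i) hw x
  have i2 : ∀ i, Integrable fun t => partialDeriv i ρ (x - t) * (w t * partialDeriv i V t) :=
    fun i => integrable_mollify_integrand (hdρ i).continuous (hρc.partialDeriv i) (hwV i) x
  have hψ := hsol (fun t => ρ (x - t)) (hρ.comp (contDiff_const.sub contDiff_id))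
    (hρc.comp_const_sub x)
  have hd : ∀ i, partialDeriv i (fun t => ρ (x - t)) = fun t => - partialDeriv i ρ (x - t) :=
    fun i => funext fun t => partialDeriv_comp_const_sub hρ1 i x t
  rw [← hψ]
  simp only [h1, mollify]
  simp only [weightedLaplacian, hd, partialDeriv_neg, Finset.mul_sum]
  simp only [partialDeriv_comp_const_sub (hdρ _)]
  simp only [← integral_add (i1 _) (i2 _)]
  rw [← integral_finsetSum _ fun i _ => (i1 i).fun_add (i2 i)]
  refine integral_congr_ae (.of_forall fun t => Finset.sum_congr rfl fun i _ => ?_)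
  ring

/-- Absorption step of the Caccioppoli estimate: `D` is the localised gradient, `k` the commutator
error and `m` the cutoff error. The two sides differ by `(D + k + 2m)²/2 + 3k²/2 + 3m²`. -/
theorem quadratic_lower_bound (D k m : ℝ) :
    D ^ 2 / 2 - 5 * m ^ 2 - 2 * k ^ 2 ≤ (D + k) * (D + 2 * m) := by
  nlinarith [sq_nonneg (D + k + 2 * m), sq_nonneg k, sq_nonneg m]

/-- Caccioppoli estimate for the mollification of a weak solution, with `u = e^V (ρ * w)`. -/
theorem IsWeakSolution.caccioppoli (hsol : IsWeakSolution V w)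
    (hV : ContDiff ℝ 1 V) (hw : LocallyIntegrable w)
    (hq : Integrable fun t => w t ^ 2 * Real.exp (V t))
    (φ : ContDiffBump (0 : EuclideanSpace ℝ (Fin n)))
    {χ : EuclideanSpace ℝ (Fin n) → ℝ} (hχ : ContDiff ℝ 1 χ) (hχc : HasCompactSupport χ)
    (hχ1 : ∀ x, |χ x| ≤ 1) {δ : ℝ} (hdχ : ∀ i x, |partialDeriv i χ x| ≤ δ)
    (hosc : ∀ x ∈ tsupport χ, ∀ t, dist t x < φ.rOut → ∀ i,
      |partialDeriv i V t - partialDeriv i V x| ≤ δ)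
    (hexp : ∀ x ∈ tsupport χ, ∀ t, dist t x < φ.rOut → Real.exp (V x) ≤ 2 * Real.exp (V t)) :
    ∫ x, (∑ i, (χ x * partialDeriv i
        (fun y => Real.exp (V y) * mollify (φ.normed volume) w y) x) ^ 2) * Real.exp (-V x)
      ≤ 28 * n * δ ^ 2 * ∫ t, w t ^ 2 * Real.exp (V t) := by
  have hρ : ContDiff ℝ ∞ (φ.normed volume) := φ.contDiff_normed
  have hρc : HasCompactSupport (φ.normed volume) := φ.hasCompactSupport_normed
  have hW : ContDiff ℝ 1 (mollify (φ.normed volume) w) :=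
    contDiff_mollify (m := 1) (hρ.of_infty 1) hρc hw
  have hG : ∀ i, ContDiff ℝ 1 (mollifiedFlux V (φ.normed volume) w i) :=
    contDiff_mollifiedFlux hV hw hρ hρc
  set ρ := φ.normed volume
  set u : EuclideanSpace ℝ (Fin n) → ℝ := fun y => Real.exp (V y) * mollify ρ w y with hu_def
  have hu : ContDiff ℝ 1 u := hV.exp.mul hW
  set q : EuclideanSpace ℝ (Fin n) → ℝ := fun t => w t ^ 2 * Real.exp (V t) with hq_def
  have hq0 : ∀ t, 0 ≤ q t := fun t => by positivity
  -- The usual Caccioppoli test function `χ² u`.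
  set ψ : EuclideanSpace ℝ (Fin n) → ℝ := fun x => χ x * χ x * u x with hψ_def
  have hψ : ContDiff ℝ 1 ψ := (hχ.mul hχ).mul hu
  have hψc : HasCompactSupport ψ := hχc.mul_right.mul_right
  have hdu : ∀ i x, partialDeriv i u x = Real.exp (V x)
      * (partialDeriv i (mollify ρ w) x + mollify ρ w x * partialDeriv i V x) := fun i x => by
    rw [hu_def, partialDeriv_mul hV.exp hW, partialDeriv_exp hV]
    ring
  have hdψ : ∀ i x, partialDeriv i ψ x
      = χ x * (χ x * partialDeriv i u x + 2 * (u x * partialDeriv i χ x)) := fun i x => by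
    rw [hψ_def, partialDeriv_mul (hχ.mul hχ) hu, partialDeriv_mul hχ hχ]
    ring
  have iG : ∀ i, Integrable fun x => mollifiedFlux V ρ w i x * partialDeriv i ψ x := fun i =>
    ((hG i).continuous.mul (hψ.continuous_partialDeriv i)).integrable_of_hasCompactSupport
      (hψc.partialDeriv i).mul_left
  have iG' : ∀ i, Integrable fun x => partialDeriv i (mollifiedFlux V ρ w i) x * ψ x := fun i =>
    (((hG i).continuous_partialDeriv i).mul hψ.continuous).integrable_of_hasCompactSupport
      hψc.mul_left
  have hzero : ∫ x, ∑ i, mollifiedFlux V ρ w i x * partialDeriv i ψ x = 0 := by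
    rw [integral_finsetSum _ fun i _ => iG i]
    simp only [fun i => integral_mul_partialDeriv (hG i) hψ hψc i]
    rw [Finset.sum_neg_distrib, ← integral_finsetSum _ fun i _ => iG' i]
    simp only [← Finset.sum_mul, hsol.sum_partialDeriv_mollifiedFlux hV hw hρ hρc]
    simp
  have iE : Integrable fun x => (∑ i, (χ x * partialDeriv i u x) ^ 2) * Real.exp (-V x) := by
    simp only [Finset.sum_mul]
    refine integrable_finsetSum _ fun i _ => ?_
    simp only [pow_two]
    exact Continuous.integrable_of_hasCompactSupport
      ((((hχ.continuous.mul (hu.continuous_partialDeriv i)).mul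
        (hχ.continuous.mul (hu.continuous_partialDeriv i)))).mul hV.neg.exp.continuous)
      hχc.mul_right.mul_right.mul_right
  have iq : Integrable (mollify ρ q) := Integrable.mollify φ.integrable_normed hq
  have hMq : ∫ x, mollify ρ q x = ∫ t, q t := by
    rw [integral_mollify φ.integrable_normed hq, φ.integral_normed, one_mul]
  -- After weighting by `e^{-V}`, each of `k²` and `m²` is at most `2 δ² (ρ * q)`, so the errors
  -- total `5·2 + 2·2 = 14`. Removing the factor `1/2` on the left gives the final 28.
  have hterm : ∀ i x, (χ x * partialDeriv i u x) ^ 2 * Real.exp (-V x) / 2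
      ≤ mollifiedFlux V ρ w i x * partialDeriv i ψ x + 14 * δ ^ 2 * mollify ρ q x := by
    intro i x
    have hMq0 : 0 ≤ mollify ρ q x := mollify_normed_nonneg φ hq0 x
    by_cases hx : x ∈ tsupport χ
    · set A := mollify ρ (fun t => |w t|) x
      have hA0 : 0 ≤ A := mollify_normed_nonneg φ (fun t => abs_nonneg _) x
      have hAq : A ^ 2 * Real.exp (V x) ≤ 2 * mollify ρ q x :=
        mollify_abs_sq_mul_exp_le φ hV.continuous hw hq.locallyIntegrable (hexp x hx)
      have hWA : |mollify ρ w x| ≤ A := abs_mollify_normed_le φ w x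
      set c := mollify ρ (fun t => w t * partialDeriv i V t) x
        - mollify ρ w x * partialDeriv i V x with hc
      have hcA : |c| ≤ δ * A := abs_mollify_mul_sub_le φ (hV.continuous_partialDeriv i) hw
        fun t ht => hosc x hx t ht i
      have he : Real.exp (-V x) * Real.exp (V x) = 1 := by rw [← Real.exp_add]; simp
      -- The flux is `e^{-V} ∂ᵢu` up to the commutator `c` between mollification and multiplication
      -- by `∂ᵢV`.
      have hflux : mollifiedFlux V ρ w i x = Real.exp (-V x) * partialDeriv i u x + c := by
        rw [hdu, ← mul_assoc, he, mollifiedFlux, hc]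
        ring
      have hb := quadratic_lower_bound (χ x * partialDeriv i u x) (χ x * c * Real.exp (V x))
        (u x * partialDeriv i χ x)
      have hb' := mul_le_mul_of_nonneg_left hb (Real.exp_pos (-V x)).le
      have e1 : Real.exp (-V x) * ((χ x * partialDeriv i u x + χ x * c * Real.exp (V x))
          * (χ x * partialDeriv i u x + 2 * (u x * partialDeriv i χ x)))
          = mollifiedFlux V ρ w i x * partialDeriv i ψ x := by
        rw [hflux, hdψ]
        linear_combination (χ x * c * (χ x * partialDeriv i u x
          + 2 * (u x * partialDeriv i χ x))) * he
      have hsq : ∀ {a b : ℝ}, |a| ≤ b → a ^ 2 ≤ b ^ 2 := fun h =>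
        sq_le_sq.2 (h.trans (le_abs_self _))
      have e2 : Real.exp (-V x) * (u x * partialDeriv i χ x) ^ 2 ≤ δ ^ 2 * (2 * mollify ρ q x) := by
        have : Real.exp (-V x) * (u x * partialDeriv i χ x) ^ 2
            = partialDeriv i χ x ^ 2 * (mollify ρ w x ^ 2 * Real.exp (V x)) := by
          simp only [hu_def]
          linear_combination (partialDeriv i χ x ^ 2 * (mollify ρ w x ^ 2 * Real.exp (V x))) * he
        rw [this]
        refine mul_le_mul (hsq (hdχ i x)) (le_trans ?_ hAq) (by positivity) (by positivity)
        gcongr ?_ * _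
        exact hsq hWA
      have e3 : Real.exp (-V x) * (χ x * c * Real.exp (V x)) ^ 2 ≤ δ ^ 2 * (2 * mollify ρ q x) := by
        have : Real.exp (-V x) * (χ x * c * Real.exp (V x)) ^ 2
            = χ x ^ 2 * (c ^ 2 * Real.exp (V x)) := by
          linear_combination (χ x ^ 2 * (c ^ 2 * Real.exp (V x))) * he
        rw [this]
        calc χ x ^ 2 * (c ^ 2 * Real.exp (V x)) ≤ 1 ^ 2 * ((δ * A) ^ 2 * Real.exp (V x)) := by
              gcongr ?_ * (?_ * _)
              · exact hsq (hχ1 x)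
              · exact hsq hcA
          _ = δ ^ 2 * (A ^ 2 * Real.exp (V x)) := by ring
          _ ≤ _ := by gcongr
      rw [e1] at hb'
      linarith
    · have h0 : χ x = 0 := image_eq_zero_of_notMem_tsupport hx
      rw [hdψ, h0]
      simp only [zero_mul, mul_zero, zero_add]
      norm_num
      positivity
  have hmono := integral_mono (iE.div_const 2)
    ((integrable_finsetSum Finset.univ fun i _ => iG i).add (iq.const_mul (14 * n * δ ^ 2)))
    fun x => (by
      simp only [Pi.add_apply]
      calc (∑ i, (χ x * partialDeriv i u x) ^ 2) * Real.exp (-V x) / 2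
          = ∑ i, (χ x * partialDeriv i u x) ^ 2 * Real.exp (-V x) / 2 := by
            rw [Finset.sum_mul, Finset.sum_div]
        _ ≤ ∑ i, (mollifiedFlux V ρ w i x * partialDeriv i ψ x + 14 * δ ^ 2 * mollify ρ q x) :=
            Finset.sum_le_sum fun i _ => hterm i x
        _ = _ := by
            rw [Finset.sum_add_distrib]
            simp
            ring :
      (∑ i, (χ x * partialDeriv i u x) ^ 2) * Real.exp (-V x) / 2 ≤ _)
  rw [integral_div] at hmono
  have hsplit := integral_add (integrable_finsetSum Finset.univ fun i _ => iG i)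
    (iq.const_mul (14 * n * δ ^ 2))
  rw [hzero, integral_const_mul, hMq] at hsplit
  have : (∫ x, (∑ i, (χ x * partialDeriv i u x) ^ 2) * Real.exp (-V x)) / 2
      ≤ 0 + 14 * n * δ ^ 2 * ∫ t, q t := hmono.trans hsplit.le
  linarith

/-- Dilating a fixed bump by `R` divides its gradient by `R`, so a large `R` both covers `K` and
flattens the slope. -/
theorem exists_cutoff {K : Set (EuclideanSpace ℝ (Fin n))} (hK : IsCompact K) {δ : ℝ}
    (hδ : 0 < δ) : ∃ χ : EuclideanSpace ℝ (Fin n) → ℝ, ContDiff ℝ 1 χ ∧ HasCompactSupport χ ∧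
      (∀ x, |χ x| ≤ 1) ∧ (∀ x ∈ K, χ x = 1) ∧ ∀ i x, |partialDeriv i χ x| ≤ δ := by
  let b : ContDiffBump (0 : EuclideanSpace ℝ (Fin n)) := ⟨1, 2, one_pos, one_lt_two⟩
  have hb : ContDiff ℝ 1 (b : EuclideanSpace ℝ (Fin n) → ℝ) := b.contDiff
  obtain ⟨C, hC⟩ := (hb.continuous_fderiv one_ne_zero).bounded_above_of_compact_support
    (b.hasCompactSupport.fderiv ℝ)
  obtain ⟨R₀, hR₀⟩ := hK.isBounded.subset_closedBall 0
  set R : ℝ := max (max R₀ 1) (C / δ)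
  have hR1 : 1 ≤ R := (le_max_right _ _).trans (le_max_left _ _)
  have hRpos : 0 < R := by linarith
  have hRC : C / δ ≤ R := le_max_right _ _
  have hRR : R₀ ≤ R := (le_max_left _ _).trans (le_max_left _ _)
  have hχ : ContDiff ℝ 1 fun x => b (R⁻¹ • x) := hb.comp (contDiff_id.const_smul R⁻¹)
  refine ⟨fun x => b (R⁻¹ • x), hχ, ?_, ?_, ?_, ?_⟩
  · exact b.hasCompactSupport.comp_homeomorph (Homeomorph.smulOfNeZero R⁻¹ (by positivity))
  · intro x
    rw [abs_of_nonneg b.nonneg]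
    exact b.le_one
  · intro x hx
    refine b.one_of_mem_closedBall ?_
    have := hR₀ hx
    simp only [mem_closedBall_zero_iff, norm_smul, norm_inv, Real.norm_eq_abs,
      abs_of_pos hRpos] at this ⊢
    change _ ≤ (1 : ℝ)
    rw [inv_mul_le_iff₀ hRpos]
    linarith
  · intro i x
    have h := (hb.differentiable one_ne_zero (R⁻¹ • x)).hasFDerivAt.comp x
      ((hasFDerivAt_id x).const_smul R⁻¹)
    have h' : fderiv ℝ (fun y => b (R⁻¹ • y)) x = _ := h.fderiv
    rw [partialDeriv, h']
    have h1 := (fderiv ℝ b (R⁻¹ • x)).le_of_opNorm_le (hC _) (EuclideanSpace.single i (1 : ℝ))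
    simp only [PiLp.norm_single, norm_one, mul_one, Real.norm_eq_abs] at h1
    simp only [ContinuousLinearMap.comp_apply, smul_apply,
      ContinuousLinearMap.id_apply, map_smul, smul_eq_mul, abs_mul, abs_inv, abs_of_pos hRpos]
    rw [inv_mul_le_iff₀ hRpos]
    rw [div_le_iff₀ hδ] at hRC
    linarith

end WeakSolution

/-! ### Vanishing weak gradient and the Liouville property -/

section Liouville

variable {n : ℕ} {V w g : EuclideanSpace ℝ (Fin n) → ℝ}

/-- Uniform continuity at a compact set. The point `t` may lie outside `K`, as the mollifier reaches
beyond the support of the cutoff. -/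
theorem exists_radius_forall_abs_sub_lt {a : EuclideanSpace ℝ (Fin n) → ℝ} (ha : Continuous a)
    {K : Set (EuclideanSpace ℝ (Fin n))} (hK : IsCompact K) {ε : ℝ} (hε : 0 < ε) :
    ∃ r > 0, ∀ x ∈ K, ∀ t, dist t x < r → |a t - a x| < ε := by
  have h := hK.uniformContinuousAt_of_continuousAt a (fun x _ => ha.continuousAt)
    (Metric.dist_mem_uniformity hε)
  obtain ⟨r, hr, h'⟩ := Metric.mem_uniformity_dist.1 h
  refine ⟨r, hr, fun x hx t ht => ?_⟩
  have h2 : dist (a x) (a t) < ε := h' (a := x) (b := t) (by rwa [dist_comm]) hx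
  rwa [dist_comm, Real.dist_eq] at h2

/-- A weak solution `w` with `∫ w² e^V < ∞` is such that `e^V w` has vanishing weak derivatives. -/
theorem IsWeakSolution.integral_mul_exp_mul_partialDeriv (hsol : IsWeakSolution V w)
    (hV : ContDiff ℝ 1 V) (hw : Integrable w)
    (hq : Integrable fun t => w t ^ 2 * Real.exp (V t))
    {ψ : EuclideanSpace ℝ (Fin n) → ℝ} (hψ : ContDiff ℝ 1 ψ) (hψc : HasCompactSupport ψ)
    (i : Fin n) : ∫ x, w x * (Real.exp (V x) * partialDeriv i ψ x) = 0 := by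
  set θ : EuclideanSpace ℝ (Fin n) → ℝ := fun x => Real.exp (V x) * partialDeriv i ψ x with hθ_def
  have hθ : Continuous θ := hV.exp.continuous.mul (hψ.continuous_partialDeriv i)
  have hθc : HasCompactSupport θ := (hψc.partialDeriv i).mul_left
  set Q := ∫ t, w t ^ 2 * Real.exp (V t)
  set M := ∫ t, |w t|
  have iB : Integrable fun x => ψ x ^ 2 * Real.exp (V x) := by
    simp only [pow_two]
    exact ((hψ.continuous.mul hψ.continuous).mul
      hV.exp.continuous).integrable_of_hasCompactSupport hψc.mul_right.mul_right
  set B := ∫ x, ψ x ^ 2 * Real.exp (V x)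
  -- The cutoff is chosen first, with slope at most `ε`; the mollification radius is then taken
  -- small enough, depending on that cutoff, for `∇V` to vary by less than `ε`, `e^V` by at most a
  -- factor 2, and `θ` by less than `ε`.
  have hmain : ∀ ε > 0, |∫ x, w x * θ x| ≤ ε * (M + (28 * n * Q + B)) := by
    intro ε hε
    obtain ⟨χ, hχ, hχc, hχ1, hχK, hdχ⟩ := exists_cutoff (n := n) hψc.isCompact hε
    have hloc : ∀ j : Fin n, ∃ r > 0, ∀ x ∈ tsupport χ, ∀ t, dist t x < r →
        |partialDeriv j V t - partialDeriv j V x| < ε := fun j =>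
      exists_radius_forall_abs_sub_lt (hV.continuous_partialDeriv j) hχc hε
    choose r hr hr' using hloc
    obtain ⟨r₁, hr₁, hr₁'⟩ := exists_radius_forall_abs_sub_lt hV.continuous hχc
      (Real.log_pos one_lt_two)
    obtain ⟨r₂, hr₂, hr₂'⟩ := Metric.uniformContinuous_iff.1
      (hθc.uniformContinuous_of_continuous hθ) ε hε
    obtain ⟨s, hs, hsr⟩ : ∃ s > 0, ∀ j, s ≤ r j := by
      rcases isEmpty_or_nonempty (Fin n) with h | h
      · exact ⟨1, one_pos, fun j => h.elim j⟩
      · obtain ⟨j, hj⟩ := Finite.exists_min r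
        exact ⟨r j, hr j, hj⟩
    set R := min s (min r₁ r₂)
    have hR0 : 0 < R := lt_min hs (lt_min hr₁ hr₂)
    let φ : ContDiffBump (0 : EuclideanSpace ℝ (Fin n)) := ⟨R / 2, R, by linarith, by linarith⟩
    have hφ1 : φ.rOut ≤ s := min_le_left _ _
    have hφ2 : φ.rOut ≤ r₁ := (min_le_right _ _).trans (min_le_left _ _)
    have hφ3 : φ.rOut ≤ r₂ := (min_le_right _ _).trans (min_le_right _ _)
    have henergy := hsol.caccioppoli hV hw.locallyIntegrable hq φ hχ hχc hχ1 hdχ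
      (fun x hx t ht j => (hr' j x hx t (ht.trans_le (hφ1.trans (hsr j)))).le)
      (fun x hx t ht => by
        have h1 := (abs_lt.1 (hr₁' x hx t (ht.trans_le hφ2))).1
        calc Real.exp (V x) ≤ Real.exp (Real.log 2 + V t) := Real.exp_le_exp.2 (by linarith)
          _ = _ := by rw [Real.exp_add, Real.exp_log two_pos])
    set ρ := φ.normed volume
    have hρ : ContDiff ℝ ∞ ρ := φ.contDiff_normed
    have hρc : HasCompactSupport ρ := φ.hasCompactSupport_normed
    have hW : ContDiff ℝ 1 (mollify ρ w) :=
      contDiff_mollify (m := 1) (hρ.of_infty 1) hρc hw.locallyIntegrable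
    set u : EuclideanSpace ℝ (Fin n) → ℝ := fun y => Real.exp (V y) * mollify ρ w y with hu_def
    have hu : ContDiff ℝ 1 u := hV.exp.mul hW
    -- the mollification error
    have h1 : |(∫ x, mollify ρ w x * θ x) - ∫ x, w x * θ x| ≤ ε * M := by
      obtain ⟨C, hC⟩ := hθ.bounded_above_of_compact_support hθc
      have hclose : ∀ t, |mollify ρ θ t - θ t| ≤ ε := fun t => by
        rw [mollify_eq_convolution, ← Real.dist_eq]
        exact φ.dist_normed_convolution_le hθ.aestronglyMeasurable
          fun y hy => (hr₂' ((Metric.mem_ball.1 hy).trans_le hφ3)).le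
      have i1 : Integrable fun x => w x * θ x :=
        hw.mul_bdd (c := C) hθ.aestronglyMeasurable (.of_forall hC)
      have hmc : Continuous (mollify ρ θ) :=
        (contDiff_mollify (m := 1) (hρ.of_infty 1) hρc hθ.locallyIntegrable).continuous
      have i2 : Integrable fun x => w x * mollify ρ θ x := by
        refine hw.mul_bdd (c := C + ε) hmc.aestronglyMeasurable (.of_forall fun t => ?_)
        have h1 := hC t
        have h2 := hclose t
        rw [Real.norm_eq_abs] at *
        have := abs_add_le (θ t) (mollify ρ θ t - θ t)
        rw [add_sub_cancel] at this
        linarith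
      rw [integral_mollify_mul hρ.continuous hρc φ.normed_neg hw hθ hθc, ← integral_sub i2 i1,
        ← integral_const_mul]
      refine abs_integral_le_integral_abs.trans (integral_mono (i2.sub' i1).abs
        (hw.abs.const_mul ε) fun t => ?_)
      simp only []
      rw [← mul_sub, abs_mul, mul_comm]
      exact mul_le_mul_of_nonneg_right (hclose t) (abs_nonneg _)
    -- the energy bound
    have h2 : |∫ x, mollify ρ w x * θ x| ≤ ε * (28 * n * Q + B) := by
      have e1 : ∫ x, mollify ρ w x * θ x = - ∫ x, partialDeriv i u x * ψ x := by
        rw [← integral_mul_partialDeriv hu hψ hψc]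
        refine integral_congr_ae (.of_forall fun x => ?_)
        simp only [hθ_def, hu_def]
        ring
      have iE : Integrable fun x =>
          (∑ j, (χ x * partialDeriv j u x) ^ 2) * Real.exp (-V x) := by
        simp only [Finset.sum_mul]
        refine integrable_finsetSum _ fun j _ => ?_
        simp only [pow_two]
        exact Continuous.integrable_of_hasCompactSupport
          ((((hχ.continuous.mul (hu.continuous_partialDeriv j)).mul
            (hχ.continuous.mul (hu.continuous_partialDeriv j)))).mul hV.neg.exp.continuous)
          hχc.mul_right.mul_right.mul_right
      have iP : Integrable fun x => partialDeriv i u x * ψ x :=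
        ((hu.continuous_partialDeriv i).mul hψ.continuous).integrable_of_hasCompactSupport
          hψc.mul_left
      -- Weighted AM–GM, using `χ = 1` on the support of `ψ`. The energy is of order `ε²`, so the
      -- weight `ε⁻¹` leaves a total of order `ε`.
      have hpt : ∀ x, |partialDeriv i u x * ψ x| ≤
          ε⁻¹ * ((∑ j, (χ x * partialDeriv j u x) ^ 2) * Real.exp (-V x))
            + ε * (ψ x ^ 2 * Real.exp (V x)) := by
        intro x
        have he : Real.exp (-V x) * Real.exp (V x) = 1 := by rw [← Real.exp_add]; simp
        by_cases hx : x ∈ tsupport ψ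
        · have hχx : χ x = 1 := hχK x hx
          have h0 : partialDeriv i u x ^ 2 ≤ ∑ j, (χ x * partialDeriv j u x) ^ 2 := by
            rw [hχx]
            simp only [one_mul]
            exact Finset.single_le_sum (f := fun j => partialDeriv j u x ^ 2)
              (fun j _ => sq_nonneg _) (Finset.mem_univ i)
          have h3 : |partialDeriv i u x * ψ x| ≤ ε⁻¹ * (partialDeriv i u x ^ 2 * Real.exp (-V x))
              + ε * (ψ x ^ 2 * Real.exp (V x)) := by
            refine abs_le_of_sq_le_sq ?_ (by positivity)
            have h4 : (partialDeriv i u x * ψ x) ^ 2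
                = (ε⁻¹ * (partialDeriv i u x ^ 2 * Real.exp (-V x)))
                  * (ε * (ψ x ^ 2 * Real.exp (V x))) := by
              have hee : ε⁻¹ * ε = 1 := inv_mul_cancel₀ hε.ne'
              calc (partialDeriv i u x * ψ x) ^ 2 = (partialDeriv i u x * ψ x) ^ 2
                    * (ε⁻¹ * ε) * (Real.exp (-V x) * Real.exp (V x)) := by rw [hee, he]; ring
                _ = _ := by ring
            have p1 : 0 ≤ ε⁻¹ * (partialDeriv i u x ^ 2 * Real.exp (-V x)) := by positivity
            have p2 : 0 ≤ ε * (ψ x ^ 2 * Real.exp (V x)) := by positivity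
            rw [h4]
            nlinarith [mul_nonneg p1 p2]
          refine h3.trans ?_
          gcongr
        · rw [image_eq_zero_of_notMem_tsupport hx]
          simp only [mul_zero, abs_zero]
          positivity
      rw [e1, abs_neg]
      calc |∫ x, partialDeriv i u x * ψ x| ≤ ∫ x, |partialDeriv i u x * ψ x| :=
            abs_integral_le_integral_abs
        _ ≤ ∫ x, (ε⁻¹ * ((∑ j, (χ x * partialDeriv j u x) ^ 2) * Real.exp (-V x))
            + ε * (ψ x ^ 2 * Real.exp (V x))) :=
            integral_mono iP.abs ((iE.const_mul _).fun_add (iB.const_mul _)) hpt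
        _ = ε⁻¹ * (∫ x, (∑ j, (χ x * partialDeriv j u x) ^ 2) * Real.exp (-V x)) + ε * B := by
            rw [integral_add (iE.const_mul _) (iB.const_mul _), integral_const_mul,
              integral_const_mul]
        _ ≤ ε⁻¹ * (28 * n * ε ^ 2 * Q) + ε * B := by gcongr
        _ = ε * (28 * n * Q + B) := by field_simp
    have h3 := abs_sub_abs_le_abs_sub (∫ x, w x * θ x) (∫ x, mollify ρ w x * θ x)
    rw [abs_sub_comm] at h3
    linarith
  have hlim : Tendsto (fun ε : ℝ => ε * (M + (28 * n * Q + B))) (𝓝[>] 0) (𝓝 0) := by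
    have : Tendsto (fun ε : ℝ => ε * (M + (28 * n * Q + B))) (𝓝 0)
        (𝓝 (0 * (M + (28 * n * Q + B)))) := (continuous_id.mul continuous_const).tendsto 0
    rw [zero_mul] at this
    exact this.mono_left nhdsWithin_le_nhds
  have := ge_of_tendsto hlim (eventually_mem_nhdsWithin.mono fun ε hε => hmain ε hε)
  exact abs_eq_zero.1 (le_antisymm this (abs_nonneg _))

theorem fderiv_eq_zero_of_partialDeriv {u : EuclideanSpace ℝ (Fin n) → ℝ}
    {x : EuclideanSpace ℝ (Fin n)} (h : ∀ i, partialDeriv i u x = 0) : fderiv ℝ u x = 0 := by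
  apply ContinuousLinearMap.coe_injective
  refine (EuclideanSpace.basisFun (Fin n) ℝ).toBasis.ext fun i => ?_
  simpa [partialDeriv] using h i

/-- A locally integrable function with vanishing weak derivatives is a.e. constant. -/
theorem ae_eq_const_of_integral_mul_partialDeriv (hg : LocallyIntegrable g)
    (h : ∀ ψ : EuclideanSpace ℝ (Fin n) → ℝ, ContDiff ℝ 1 ψ → HasCompactSupport ψ →
      ∀ i, ∫ x, g x * partialDeriv i ψ x = 0) :
    ∃ c : ℝ, ∀ᵐ x, g x = c := by
  let φ : ℕ → ContDiffBump (0 : EuclideanSpace ℝ (Fin n)) := fun k =>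
    ⟨1 / ((k : ℝ) + 1), 2 * (1 / ((k : ℝ) + 1)), by positivity,
      by have : 0 < 1 / ((k : ℝ) + 1) := by positivity
         linarith⟩
  have hφ : Tendsto (fun k => (φ k).rOut) atTop (𝓝 0) := by
    have h2 := (tendsto_one_div_add_atTop_nhds_zero_nat (𝕜 := ℝ)).const_mul 2
    rwa [mul_zero] at h2
  -- The hypothesis tested against `t ↦ ρ(y - t)` kills the gradient of each mollification, which is
  -- therefore constant.
  have hconst : ∀ k x, mollify ((φ k).normed volume) g x = mollify ((φ k).normed volume) g 0 := by
    intro k x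
    have hρ : ContDiff ℝ ∞ ((φ k).normed volume) := (φ k).contDiff_normed
    have hρc : HasCompactSupport ((φ k).normed volume) := (φ k).hasCompactSupport_normed
    refine is_const_of_fderiv_eq_zero (𝕜 := ℝ) ((contDiff_mollify (m := 1) (hρ.of_infty 1) hρc
      hg).differentiable one_ne_zero) (fun y => fderiv_eq_zero_of_partialDeriv fun i => ?_) x 0
    rw [partialDeriv_mollify (hρ.of_infty 1) hρc hg]
    have h' := h (fun t => (φ k).normed volume (y - t))
      ((hρ.of_infty 1).comp (contDiff_const.sub contDiff_id)) (hρc.comp_const_sub y) i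
    simp only [partialDeriv_comp_const_sub (hρ.of_infty 1), mul_neg, integral_neg,
      neg_eq_zero] at h'
    rw [← h', mollify]
    exact integral_congr_ae (.of_forall fun t => mul_comm _ _)
  -- Here `K` bounds the ratio of outer to inner radius, which equals 2 for every bump. Constants
  -- that converge a.e. to `g` force `g` to be constant.
  have hae := ContDiffBump.ae_convolution_tendsto_right_of_locallyIntegrable (K := 2) hφ
    (.of_forall fun k => le_rfl) hg
  simp only [← mollify_eq_convolution, hconst] at hae
  obtain ⟨x₀, hx₀⟩ := hae.exists
  exact ⟨g x₀, hae.mono fun x hx => tendsto_nhds_unique hx hx₀⟩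

end Liouville

/-! ### The Gibbs measure and density of the range of `L` -/

/-- The measure `e^{-V} dx`. -/
noncomputable def gibbsMeasure {n : ℕ} (V : EuclideanSpace ℝ (Fin n) → ℝ) :
    Measure (EuclideanSpace ℝ (Fin n)) :=
  volume.withDensity fun x => ENNReal.ofReal (Real.exp (-V x))

section Gibbs

variable {n : ℕ} {V f g u : EuclideanSpace ℝ (Fin n) → ℝ}

theorem integral_gibbsMeasure (hV : Continuous V) (u : EuclideanSpace ℝ (Fin n) → ℝ) :
    ∫ x, u x ∂gibbsMeasure V = ∫ x, u x * Real.exp (-V x) := by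
  rw [gibbsMeasure, integral_withDensity_eq_integral_toReal_smul (by fun_prop) (by simp)]
  refine integral_congr_ae (.of_forall fun x => ?_)
  simp only [smul_eq_mul, ENNReal.toReal_ofReal (Real.exp_pos _).le]
  ring

theorem integrable_gibbsMeasure_iff (hV : Continuous V) :
    Integrable u (gibbsMeasure V) ↔ Integrable fun x => u x * Real.exp (-V x) := by
  rw [gibbsMeasure, integrable_withDensity_iff (by fun_prop) (by simp)]
  simp only [ENNReal.toReal_ofReal (Real.exp_pos _).le]

theorem gibbsMeasure_absolutelyContinuous (V : EuclideanSpace ℝ (Fin n) → ℝ) :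
    gibbsMeasure V ≪ volume :=
  withDensity_absolutelyContinuous _ _

theorem memLp_weightedLaplacian [IsFiniteMeasure (gibbsMeasure V)] (hV : ContDiff ℝ 1 V)
    (hh : ContDiff ℝ 2 u) (hhc : HasCompactSupport u) :
    MemLp (weightedLaplacian V u) 2 (gibbsMeasure V) :=
  (continuous_weightedLaplacian hV hh).memLp_of_hasCompactSupport (hhc.weightedLaplacian V)

/-- Liouville property: an `L²` function orthogonal to the range of `L` is constant. -/
theorem ae_eq_const_of_integral_mul_weightedLaplacian [IsFiniteMeasure (gibbsMeasure V)]
    (hV : ContDiff ℝ 1 V) (hg : MemLp g 2 (gibbsMeasure V))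
    (h : ∀ ψ : EuclideanSpace ℝ (Fin n) → ℝ, ContDiff ℝ ∞ ψ → HasCompactSupport ψ →
      ∫ x, g x * weightedLaplacian V ψ x ∂gibbsMeasure V = 0) :
    ∃ c : ℝ, ∀ᵐ x ∂gibbsMeasure V, g x = c := by
  have he : ∀ x, Real.exp (-V x) * Real.exp (V x) = 1 := fun x => by rw [← Real.exp_add]; simp
  have hw : Integrable fun x => g x * Real.exp (-V x) :=
    (integrable_gibbsMeasure_iff hV.continuous).1 (hg.integrable one_le_two)
  have hq : Integrable fun x => (g x * Real.exp (-V x)) ^ 2 * Real.exp (V x) := by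
    refine ((integrable_gibbsMeasure_iff hV.continuous).1 hg.integrable_sq).congr
      (.of_forall fun x => ?_)
    linear_combination (-(g x ^ 2 * Real.exp (-V x))) * he x
  have hsol : IsWeakSolution V fun x => g x * Real.exp (-V x) := fun ψ hψ hψc => by
    rw [← h ψ hψ hψc, integral_gibbsMeasure hV.continuous]
    exact integral_congr_ae (.of_forall fun x => by ring)
  have hgl : LocallyIntegrable g := by
    have := hw.locallyIntegrable.mul_continuous hV.exp.continuous
    simpa only [mul_assoc, he, mul_one] using this
  obtain ⟨c, hc⟩ := ae_eq_const_of_integral_mul_partialDeriv hgl fun ψ hψ hψc i => by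
    rw [← hsol.integral_mul_exp_mul_partialDeriv hV hw hq hψ hψc i]
    refine integral_congr_ae (.of_forall fun x => ?_)
    linear_combination (-(g x * partialDeriv i ψ x)) * he x
  exact ⟨c, (gibbsMeasure_absolutelyContinuous V).ae_le hc⟩

/-- The range of `L` on test functions is dense in the mean-zero functions of `L²`. -/
theorem exists_weightedLaplacian_approx [IsFiniteMeasure (gibbsMeasure V)] (hV : ContDiff ℝ 1 V)
    (hf : MemLp f 2 (gibbsMeasure V)) (hf0 : ∫ x, f x ∂gibbsMeasure V = 0) {ε : ℝ} (hε : 0 < ε) :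
    ∃ h : EuclideanSpace ℝ (Fin n) → ℝ, ContDiff ℝ ∞ h ∧ HasCompactSupport h ∧
      ∫ x, (weightedLaplacian V h x - f x) ^ 2 ∂gibbsMeasure V ≤ ε ^ 2 := by
  let S : Submodule ℝ (Lp ℝ 2 (gibbsMeasure V)) :=
    { carrier := {G | ∃ h : EuclideanSpace ℝ (Fin n) → ℝ, ContDiff ℝ ∞ h ∧ HasCompactSupport h ∧
        G =ᵐ[gibbsMeasure V] weightedLaplacian V h}
      zero_mem' := by
        refine ⟨fun _ => 0, contDiff_const, HasCompactSupport.zero, ?_⟩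
        filter_upwards [Lp.coeFn_zero ℝ 2 (gibbsMeasure V)] with x hx
        rw [hx]
        have h0 : ∀ i : Fin n, partialDeriv i (fun _ => 0) = fun _ => 0 :=
          fun i => funext fun y => by simp [partialDeriv]
        simp [weightedLaplacian, h0]
      add_mem' := by
        rintro G₁ G₂ ⟨h₁, c₁, k₁, e₁⟩ ⟨h₂, c₂, k₂, e₂⟩
        refine ⟨h₁ + h₂, c₁.add c₂, k₁.add k₂, ?_⟩
        filter_upwards [Lp.coeFn_add G₁ G₂, e₁, e₂] with x hx hx₁ hx₂
        rw [hx, weightedLaplacian_add V (c₁.of_infty 2) (c₂.of_infty 2)]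
        simp [hx₁, hx₂]
      smul_mem' := by
        rintro a G ⟨h, c, k, e⟩
        refine ⟨a • h, contDiff_const.smul c, k.smul_left (f := fun _ => a), ?_⟩
        filter_upwards [Lp.coeFn_smul a G, e] with x hx hx₁
        rw [hx, weightedLaplacian_smul V a (c.of_infty 2)]
        simp [hx₁] }
  have hmem : hf.toLp f ∈ S.topologicalClosure := by
    -- The closure of the range is its double orthogonal complement. By the Liouville property
    -- anything orthogonal to the range is constant, hence orthogonal to the mean-zero `f`.
    rw [← Submodule.orthogonal_orthogonal_eq_closure, Submodule.mem_orthogonal]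
    intro G hG
    rw [Submodule.mem_orthogonal] at hG
    obtain ⟨c, hc⟩ := ae_eq_const_of_integral_mul_weightedLaplacian hV (Lp.memLp G)
      fun ψ hψ hψc => by
        have hm := memLp_weightedLaplacian hV (hψ.of_infty 2) hψc
        have := hG (hm.toLp _) ⟨ψ, hψ, hψc, hm.coeFn_toLp⟩
        rw [L2.inner_def] at this
        rw [← this]
        refine integral_congr_ae ?_
        filter_upwards [hm.coeFn_toLp] with x hx
        rw [hx]
        simp
    rw [L2.inner_def]
    calc ∫ x, inner ℝ (G x) (hf.toLp f x) ∂gibbsMeasure V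
        = ∫ x, c * f x ∂gibbsMeasure V := by
          refine integral_congr_ae ?_
          filter_upwards [hf.coeFn_toLp, hc] with x hx hx'
          rw [hx, hx']
          simp [mul_comm]
      _ = 0 := by rw [integral_const_mul, hf0, mul_zero]
  obtain ⟨G, ⟨h, hh, hhc, hG⟩, hdist⟩ := Metric.mem_closure_iff.1 hmem ε hε
  refine ⟨h, hh, hhc, ?_⟩
  rw [dist_comm, dist_eq_norm] at hdist
  have hn : ∫ x, (weightedLaplacian V h x - f x) ^ 2 ∂gibbsMeasure V
      = ‖G - hf.toLp f‖ ^ 2 := by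
    rw [← real_inner_self_eq_norm_sq, L2.inner_def]
    refine integral_congr_ae ?_
    filter_upwards [hf.coeFn_toLp, hG, Lp.coeFn_sub G (hf.toLp f)] with x hx hx' hx''
    rw [hx'', Pi.sub_apply, hx, hx']
    simp [pow_two]
  rw [hn]
  gcongr

/-! ### The inequality for square integrable functions -/

/-- Domination by `2u² + 2 ∇f·(Hess V)⁻¹∇f`: Cauchy–Schwarz bounds the square of the mixed term by
the energy times `∇V·(Hess V)⁻¹∇V`, which the denominator absorbs. A general `u` is needed, since
both `f` and `L h` are inserted. -/
theorem integrable_defect (hn : 0 < n) (hV : ContDiff ℝ 2 V)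
    (hVpos : ∀ x, (hessianMatrix V x).PosDef) (hf : ContDiff ℝ 1 f)
    (hE : Integrable (gradHessInv V f f) (gibbsMeasure V)) (hu : Continuous u)
    (hu2 : MemLp u 2 (gibbsMeasure V)) :
    Integrable (fun x => (u x - gradHessInv V f V x) ^ 2 / ((n : ℝ) + gradHessInv V V V x))
      (gibbsMeasure V) := by
  have hn' : (1 : ℝ) ≤ n := by exact_mod_cast hn
  have hV1 : ContDiff ℝ 1 V := hV.of_le (by norm_num)
  have hb0 : ∀ x, 0 ≤ gradHessInv V V V x := gradHessInv_self_nonneg hVpos V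
  have hcont : Continuous fun x =>
      (u x - gradHessInv V f V x) ^ 2 / ((n : ℝ) + gradHessInv V V V x) :=
    ((hu.sub (continuous_gradHessInv hV hVpos hf hV1)).pow 2).div
      (continuous_const.add (continuous_gradHessInv hV hVpos hV1 hV1))
      fun x => by have := hb0 x; positivity
  refine ((hu2.integrable_sq.const_mul 2).add (hE.const_mul 2)).mono'
    hcont.aestronglyMeasurable (.of_forall fun x => ?_)
  have hb := hb0 x
  have hcs := gradHessInv_sq_le hVpos f V x
  have hE0 := gradHessInv_self_nonneg hVpos f x
  rw [Real.norm_eq_abs, abs_of_nonneg (by positivity), div_le_iff₀ (by positivity)]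
  simp only [Pi.add_apply]
  have h1 : (u x - gradHessInv V f V x) ^ 2 ≤ 2 * u x ^ 2 + 2 * gradHessInv V f V x ^ 2 := by
    nlinarith [sq_nonneg (u x + gradHessInv V f V x)]
  have h2 : u x ^ 2 * 1 ≤ u x ^ 2 * (n + gradHessInv V V V x) := by
    gcongr
    linarith
  have h3 : gradHessInv V f f x * gradHessInv V V V x
      ≤ gradHessInv V f f x * (n + gradHessInv V V V x) := by
    gcongr
    linarith
  linarith

/-- The dual estimate tested against `h`. -/
theorem integral_sq_le_of_test (hn : 0 < n) [IsFiniteMeasure (gibbsMeasure V)]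
    (hV : ContDiff ℝ 2 V) (hVpos : ∀ x, (hessianMatrix V x).PosDef) (hf : ContDiff ℝ 1 f)
    (hE : Integrable (gradHessInv V f f) (gibbsMeasure V)) (hf2 : MemLp f 2 (gibbsMeasure V))
    {h : EuclideanSpace ℝ (Fin n) → ℝ} (hh : ContDiff ℝ 3 h) (hhc : HasCompactSupport h) :
    ∫ x, f x ^ 2 ∂gibbsMeasure V ≤ ∫ x, gradHessInv V f f x ∂gibbsMeasure V
      - ∫ x, (weightedLaplacian V h x - gradHessInv V f V x) ^ 2
          / ((n : ℝ) + gradHessInv V V V x) ∂gibbsMeasure V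
      + ∫ x, (weightedLaplacian V h x - f x) ^ 2 ∂gibbsMeasure V := by
  have hV1 : ContDiff ℝ 1 V := hV.of_le (by norm_num)
  have hh2 : ContDiff ℝ 2 h := hh.of_le (by norm_num)
  have hL := memLp_weightedLaplacian hV1 hh2 hhc
  have hLc := continuous_weightedLaplacian hV1 hh2
  have iT := integrable_defect hn hV hVpos hf hE hLc hL
  have iLf : Integrable (fun x => f x * weightedLaplacian V h x) (gibbsMeasure V) :=
    hf2.integrable_mul hL
  have h1 : ∀ i, ContDiff ℝ 1 (partialDeriv i h) := hh2.partialDeriv (by norm_num)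
  have hdh : ∀ i, Continuous (partialDeriv i h) := fun i => (h1 i).continuous
  have i1 : Integrable (fun x => ∑ i, partialDeriv i f x * partialDeriv i h x)
      (gibbsMeasure V) := integrable_finsetSum _ fun i _ =>
    ((hf.continuous_partialDeriv i).mul (hdh i)).integrable_of_hasCompactSupport
      (hhc.partialDeriv i).mul_left
  have hH : ∀ j i, Continuous fun x => hessianMatrix V x j i := fun j i =>
    (hV.partialDeriv (k := 1) (by norm_num) i).continuous_partialDeriv j
  have i2 : Integrable (fun x => ∑ j, ((∑ i, partialDeriv i (partialDeriv j h) x ^ 2)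
      + partialDeriv j h x * ∑ i, hessianMatrix V x j i * partialDeriv i h x))
      (gibbsMeasure V) := by
    refine integrable_finsetSum _ fun j _ => Integrable.fun_add
      (integrable_finsetSum _ fun i _ => ?_) ?_
    · simp only [pow_two]
      exact (((h1 j).continuous_partialDeriv i).mul
        ((h1 j).continuous_partialDeriv i)).integrable_of_hasCompactSupport
        ((hhc.partialDeriv j).partialDeriv i).mul_right
    · exact ((hdh j).mul (continuous_finsetSum _ fun i _ => (hH j i).mul
        (hdh i))).integrable_of_hasCompactSupport (hhc.partialDeriv j).mul_right
  -- The pointwise bound is integrated; the identities `hibp`, `hboch` and `hexpand` then convert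
  -- its left side to `∫ f² - ∫ (L h - f)²`.
  have hint := integral_mono ((i1.const_mul (-2)).sub' i2) (hE.sub' iT)
    (pointwise_dimensional_bound hn hVpos hV1 hf h)
  rw [integral_sub (i1.const_mul (-2)) i2, integral_sub hE iT, integral_const_mul] at hint
  have hibp := integral_mul_weightedLaplacian hV1 hf hh2 hhc
  have hboch := integral_weightedLaplacian_sq hV hh hhc
  rw [← integral_gibbsMeasure hV1.continuous fun x => f x * weightedLaplacian V h x,
    ← integral_gibbsMeasure hV1.continuous
      fun x => ∑ i, partialDeriv i f x * partialDeriv i h x] at hibp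
  rw [← integral_gibbsMeasure hV1.continuous fun x => weightedLaplacian V h x ^ 2,
    ← integral_gibbsMeasure hV1.continuous
      fun x => ∑ j, ((∑ i, partialDeriv i (partialDeriv j h) x ^ 2)
        + partialDeriv j h x * ∑ i, hessianMatrix V x j i * partialDeriv i h x)] at hboch
  have hexpand : ∫ x, (weightedLaplacian V h x - f x) ^ 2 ∂gibbsMeasure V
      = ∫ x, weightedLaplacian V h x ^ 2 ∂gibbsMeasure V
        - 2 * ∫ x, f x * weightedLaplacian V h x ∂gibbsMeasure V
        + ∫ x, f x ^ 2 ∂gibbsMeasure V := by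
    rw [← integral_const_mul, ← integral_sub hL.integrable_sq (iLf.const_mul 2),
      ← integral_add (hL.integrable_sq.sub' (iLf.const_mul 2)) hf2.integrable_sq]
    exact integral_congr_ae (.of_forall fun x => by ring)
  linarith

/-- The dimensional Brascamp–Lieb inequality for mean-zero functions in `L²`. -/
theorem integral_sq_le_of_memLp (hn : 0 < n) [IsFiniteMeasure (gibbsMeasure V)]
    (hV : ContDiff ℝ 2 V) (hVpos : ∀ x, (hessianMatrix V x).PosDef) (hf : ContDiff ℝ 1 f)
    (hE : Integrable (gradHessInv V f f) (gibbsMeasure V)) (hf2 : MemLp f 2 (gibbsMeasure V))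
    (hf0 : ∫ x, f x ∂gibbsMeasure V = 0) :
    ∫ x, f x ^ 2 ∂gibbsMeasure V ≤ ∫ x, gradHessInv V f f x ∂gibbsMeasure V
      - ∫ x, (f x - gradHessInv V f V x) ^ 2 / ((n : ℝ) + gradHessInv V V V x)
        ∂gibbsMeasure V := by
  have hV1 : ContDiff ℝ 1 V := hV.of_le (by norm_num)
  have hn' : (1 : ℝ) ≤ n := by exact_mod_cast hn
  have iT := integrable_defect hn hV hVpos hf hE hf.continuous hf2
  set T := ∫ x, (f x - gradHessInv V f V x) ^ 2 / ((n : ℝ) + gradHessInv V V V x)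
    ∂gibbsMeasure V with hT
  have hmain : ∀ s : ℝ, 0 < s → ∫ x, f x ^ 2 ∂gibbsMeasure V
      ≤ (∫ x, gradHessInv V f f x ∂gibbsMeasure V - T) + s * (T + 1 + s) := by
    intro s hs
    obtain ⟨h, hh, hhc, hr⟩ := exists_weightedLaplacian_approx hV1 hf2 hf0 hs
    have hh3 : ContDiff ℝ 3 h := hh.of_infty 3
    have hh2 : ContDiff ℝ 2 h := hh.of_infty 2
    have hL := memLp_weightedLaplacian hV1 hh2 hhc
    have htest := integral_sq_le_of_test hn hV hVpos hf hE hf2 hh3 hhc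
    have iTh := integrable_defect hn hV hVpos hf hE (continuous_weightedLaplacian hV1 hh2) hL
    have ir : Integrable (fun x => (weightedLaplacian V h x - f x) ^ 2) (gibbsMeasure V) :=
      (hL.sub hf2).integrable_sq
    have hcmp := integral_mono ((iT.const_mul (1 - s)).sub' (ir.const_mul s⁻¹)) iTh fun x => (by
      have hb := gradHessInv_self_nonneg hVpos V x
      set D := (n : ℝ) + gradHessInv V V V x
      have hD : 1 ≤ D := by simp only [D]; linarith
      set a := f x - gradHessInv V f V x
      set r := weightedLaplacian V h x - f x
      have e : weightedLaplacian V h x - gradHessInv V f V x = a + r := by simp only [a, r]; ring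
      simp only [e]
      -- Young's inequality with weight `s` compares the defect of `L h` with that of `f`. As `∫ r²
      -- ≤ s²`, the error `s⁻¹ ∫ r²` is at most `s`; the denominator `D ≥ 1` can be dropped from
      -- that term.
      have h1 : (1 - s) * a ^ 2 - s⁻¹ * r ^ 2 ≤ (a + r) ^ 2 := by
        have h2 : 0 ≤ s * (a + s⁻¹ * r) ^ 2 := by positivity
        have h3 : s * (a + s⁻¹ * r) ^ 2 = s * a ^ 2 + 2 * (a * r) + s⁻¹ * r ^ 2 := by
          field_simp
          ring
        nlinarith [sq_nonneg r]
      calc (1 - s) * (a ^ 2 / D) - s⁻¹ * r ^ 2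
          ≤ (1 - s) * (a ^ 2 / D) - s⁻¹ * r ^ 2 / D := by
            gcongr
            exact div_le_self (by positivity) hD
        _ = ((1 - s) * a ^ 2 - s⁻¹ * r ^ 2) / D := by ring
        _ ≤ (a + r) ^ 2 / D := by gcongr :
      (1 - s) * ((f x - gradHessInv V f V x) ^ 2 / ((n : ℝ) + gradHessInv V V V x))
        - s⁻¹ * (weightedLaplacian V h x - f x) ^ 2 ≤ _)
    rw [integral_sub (iT.const_mul _) (ir.const_mul _), integral_const_mul, integral_const_mul,
      ← hT] at hcmp
    have hrs : s⁻¹ * ∫ x, (weightedLaplacian V h x - f x) ^ 2 ∂gibbsMeasure V ≤ s := by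
      rw [inv_mul_le_iff₀ hs]
      linarith
    nlinarith
  have hlim : Tendsto (fun s : ℝ => (∫ x, gradHessInv V f f x ∂gibbsMeasure V - T)
      + s * (T + 1 + s)) (𝓝[>] 0) (𝓝 (∫ x, gradHessInv V f f x ∂gibbsMeasure V - T)) := by
    have : Continuous fun s : ℝ => (∫ x, gradHessInv V f f x ∂gibbsMeasure V - T)
      + s * (T + 1 + s) := by fun_prop
    have h0 := this.tendsto 0
    rw [zero_mul, add_zero] at h0
    exact h0.mono_left nhdsWithin_le_nhds
  exact ge_of_tendsto hlim (eventually_mem_nhdsWithin.mono fun s hs => hmain s hs)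

/-! ### Square integrability by truncation -/

theorem tendsto_mul_sin_div (t : ℝ) :
    Tendsto (fun k : ℕ => ((k : ℝ) + 1) * Real.sin (t / ((k : ℝ) + 1))) atTop (𝓝 t) := by
  have hd : HasDerivAt (fun s : ℝ => Real.sin (s * t)) t 0 := by
    simpa using ((hasDerivAt_id (0 : ℝ)).mul_const t).sin
  have h := hasDerivAt_iff_tendsto_slope_zero.1 hd
  have hk : Tendsto (fun k : ℕ => 1 / ((k : ℝ) + 1)) atTop (𝓝[≠] 0) :=
    tendsto_nhdsWithin_iff.2 ⟨tendsto_one_div_add_atTop_nhds_zero_nat,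
      .of_forall fun k => by simp only [Set.mem_compl_iff, Set.mem_singleton_iff]; positivity⟩
  refine (h.comp hk).congr fun k => ?_
  simp only [Function.comp_apply, zero_add, zero_mul, Real.sin_zero, sub_zero, smul_eq_mul]
  rw [one_div, inv_inv, inv_mul_eq_div]

/-- An integrable function with finite Brascamp–Lieb energy is square integrable. -/
theorem memLp_two_of_integrable_gradHessInv (hn : 0 < n) [IsProbabilityMeasure (gibbsMeasure V)]
    (hV : ContDiff ℝ 2 V) (hVpos : ∀ x, (hessianMatrix V x).PosDef) (hf : ContDiff ℝ 1 f)
    (hE : Integrable (gradHessInv V f f) (gibbsMeasure V)) (hf1 : Integrable f (gibbsMeasure V)) :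
    MemLp f 2 (gibbsMeasure V) := by
  set C := ∫ x, gradHessInv V f f x ∂gibbsMeasure V + (∫ x, |f x| ∂gibbsMeasure V) ^ 2 with hC
  -- The sine gives a truncation that is smooth, bounded, 1-Lipschitz in `f` and dominated by `|f|`.
  let F : ℕ → EuclideanSpace ℝ (Fin n) → ℝ := fun k x =>
    ((k : ℝ) + 1) * Real.sin (f x / ((k : ℝ) + 1))
  have hFc : ∀ k, Continuous (F k) := fun k => by
    have := hf.continuous
    fun_prop
  have hFb : ∀ k x, |F k x| ≤ (k : ℝ) + 1 := fun k x => by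
    simp only [F, abs_mul, abs_of_pos (by positivity : (0 : ℝ) < (k : ℝ) + 1)]
    exact mul_le_of_le_one_right (by positivity) (Real.abs_sin_le_one _)
  have hFf : ∀ k x, |F k x| ≤ |f x| := fun k x => by
    have hk : (0 : ℝ) < (k : ℝ) + 1 := by positivity
    simp only [F, abs_mul, abs_of_pos hk]
    calc ((k : ℝ) + 1) * |Real.sin (f x / ((k : ℝ) + 1))|
        ≤ ((k : ℝ) + 1) * |f x / ((k : ℝ) + 1)| := by
          exact mul_le_mul_of_nonneg_left Real.abs_sin_le_abs hk.le
      _ = |f x| := by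
          rw [abs_div, abs_of_pos hk]
          field_simp
  have hF2 : ∀ k, MemLp (F k) 2 (gibbsMeasure V) := fun k =>
    MemLp.of_bound (hFc k).aestronglyMeasurable ((k : ℝ) + 1) (.of_forall (hFb k))
  have hbound : ∀ k, ∫ x, F k x ^ 2 ∂gibbsMeasure V ≤ C := by
    intro k
    have hk : (0 : ℝ) < (k : ℝ) + 1 := by positivity
    set m := ∫ x, F k x ∂gibbsMeasure V with hm
    have iF : Integrable (F k) (gibbsMeasure V) := (hF2 k).integrable one_le_two
    let φ : ℝ → ℝ := fun t => ((k : ℝ) + 1) * Real.sin (t / ((k : ℝ) + 1)) - m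
    have hφ : ContDiff ℝ 1 φ := by fun_prop
    have hdφ : ∀ t, deriv φ t ^ 2 ≤ 1 := fun t => by
      have hd : HasDerivAt φ (Real.cos (t / ((k : ℝ) + 1))) t := by
        have := ((((hasDerivAt_id t).div_const ((k : ℝ) + 1)).sin).const_mul
          ((k : ℝ) + 1)).sub_const m
        convert! this using 1
        simp
        field_simp
      rw [hd.deriv]
      exact Real.cos_sq_le_one _
    have hG : ContDiff ℝ 1 fun x => φ (f x) := hφ.comp hf
    have hGle : ∀ x, gradHessInv V (fun x => φ (f x)) (fun x => φ (f x)) x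
        ≤ gradHessInv V f f x := fun x => by
      rw [gradHessInv_comp hφ hf]
      exact mul_le_of_le_one_left (gradHessInv_self_nonneg hVpos f x) (hdφ _)
    have hGE : Integrable (gradHessInv V (fun x => φ (f x)) (fun x => φ (f x)))
        (gibbsMeasure V) :=
      hE.mono' (continuous_gradHessInv hV hVpos hG hG).aestronglyMeasurable
        (.of_forall fun x => by
          rw [Real.norm_eq_abs, abs_of_nonneg (gradHessInv_self_nonneg hVpos _ x)]
          exact hGle x)
    have hG2 : MemLp (fun x => φ (f x)) 2 (gibbsMeasure V) := (hF2 k).sub (memLp_const m)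
    have hG0 : ∫ x, φ (f x) ∂gibbsMeasure V = 0 := by
      change ∫ x, (F k x - m) ∂gibbsMeasure V = 0
      rw [integral_sub iF (integrable_const _)]
      simp [hm]
    -- Dropping the nonnegative defect leaves a bound on the variance of `F k` by the energy of `f`.
    -- The squared mean is controlled by `(∫ |f|)²`, so the bound `C` is uniform in `k` and Fatou's
    -- lemma applies.
    have hBL := integral_sq_le_of_memLp hn hV hVpos hG hGE hG2 hG0
    have hT0 : 0 ≤ ∫ x, (φ (f x) - gradHessInv V (fun x => φ (f x)) V x) ^ 2
        / ((n : ℝ) + gradHessInv V V V x) ∂gibbsMeasure V :=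
      integral_nonneg fun x => by
        have := gradHessInv_self_nonneg hVpos V x
        simp only [Pi.zero_apply]
        positivity
    have hEle := integral_mono hGE hE hGle
    have hvar : ∫ x, φ (f x) ^ 2 ∂gibbsMeasure V = ∫ x, F k x ^ 2 ∂gibbsMeasure V - m ^ 2 := by
      have e : ∀ x, φ (f x) ^ 2 = F k x ^ 2 - 2 * m * F k x + m ^ 2 := fun x => by
        simp only [φ, F]
        ring
      simp only [e]
      rw [integral_add ((hF2 k).integrable_sq.sub' (iF.const_mul _)) (integrable_const _),
        integral_sub (hF2 k).integrable_sq (iF.const_mul _), integral_const_mul, ← hm]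
      simp
      ring
    have hmle : m ^ 2 ≤ (∫ x, |f x| ∂gibbsMeasure V) ^ 2 := by
      refine sq_le_sq.2 (le_trans ?_ (le_abs_self _))
      exact abs_integral_le_integral_abs.trans (integral_mono iF.abs hf1.abs (hFf k))
    linarith
  rw [memLp_two_iff_integrable_sq hf.continuous.aestronglyMeasurable]
  refine ⟨(hf.continuous.pow 2).aestronglyMeasurable, ?_⟩
  rw [hasFiniteIntegral_iff_ofReal (.of_forall fun x => sq_nonneg _)]
  have hle : ∀ k, ∫⁻ x, ENNReal.ofReal (F k x ^ 2) ∂gibbsMeasure V ≤ ENNReal.ofReal C := by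
    intro k
    rw [← ofReal_integral_eq_lintegral_ofReal (hF2 k).integrable_sq
      (.of_forall fun x => sq_nonneg _)]
    exact ENNReal.ofReal_le_ofReal (hbound k)
  calc ∫⁻ x, ENNReal.ofReal (f x ^ 2) ∂gibbsMeasure V
      = ∫⁻ x, liminf (fun k => ENNReal.ofReal (F k x ^ 2)) atTop ∂gibbsMeasure V := by
        refine lintegral_congr fun x => ?_
        exact (ENNReal.tendsto_ofReal ((tendsto_mul_sin_div (f x)).pow 2)).liminf_eq.symm
    _ ≤ liminf (fun k => ∫⁻ x, ENNReal.ofReal (F k x ^ 2) ∂gibbsMeasure V) atTop :=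
        lintegral_liminf_le fun k => ((hFc k).pow 2).measurable.ennreal_ofReal
    _ ≤ ENNReal.ofReal C := by
        refine liminf_le_of_le (by isBoundedDefault) fun b hb => ?_
        obtain ⟨k, hk⟩ := hb.exists
        exact hk.trans (hle k)
    _ < ⊤ := ENNReal.ofReal_lt_top

end Gibbs

/-! ### Conclusion -/

theorem theorem4p2 {n : ℕ} (V : EuclideanSpace ℝ (Fin n) → ℝ) (hV : ContDiff ℝ 2 V)
    (hVpos : ∀ x, (hessianMatrix V x).PosDef)
    (μ : MeasureTheory.Measure (EuclideanSpace ℝ (Fin n)))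
    [MeasureTheory.IsProbabilityMeasure μ]
    (hμ : μ = MeasureTheory.volume.withDensity fun x => ENNReal.ofReal (Real.exp (-V x)))
    (f : EuclideanSpace ℝ (Fin n) → ℝ) (hf : ContDiff ℝ ∞ f)
    (hfint : MeasureTheory.Integrable f μ) (hf0 : ∫ x, f x ∂μ = 0)
    (hE : MeasureTheory.Integrable (fun x => gradHessInv V f f x) μ) :
    MeasureTheory.MemLp f 2 μ ∧
    MeasureTheory.Integrable
      (fun x => (f x - gradHessInv V f V x) ^ 2 / ((n : ℝ) + gradHessInv V V V x)) μ ∧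
    ProbabilityTheory.variance f μ ≤
      ∫ x, gradHessInv V f f x ∂μ -
        ∫ x, (f x - gradHessInv V f V x) ^ 2 / ((n : ℝ) + gradHessInv V V V x) ∂μ := by
  have hf1 : ContDiff ℝ 1 f := hf.of_infty 1
  rw [ProbabilityTheory.variance_of_integral_eq_zero hf.continuous.aemeasurable hf0]
  rcases Nat.eq_zero_or_pos n with rfl | hn
  -- In dimension zero the space is a point and mean zero forces `f = 0`. The case is separate
  -- because the general argument divides by `n`.
  · have hconst : ∀ x, f x = f 0 := fun x => congrArg f (Subsingleton.elim _ _)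
    have hzero : ∀ x, f x = 0 := by
      simp only [hconst, integral_const, probReal_univ, one_smul] at hf0
      exact fun x => (hconst x).trans hf0
    have hf' : f = fun _ => 0 := funext hzero
    subst hf'
    simp [gradHessInv]
  · obtain rfl : μ = gibbsMeasure V := hμ
    have hf2 := memLp_two_of_integrable_gradHessInv hn hV hVpos hf1 hE hfint
    exact ⟨hf2, integrable_defect hn hV hVpos hf1 hE hf1.continuous hf2,
      integral_sq_le_of_memLp hn hV hVpos hf1 hE hf2 hf0⟩
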